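/- Let $n\ge 1$ and let $p(\cdot):\mathbb R^n\to(0,\infty)$ be a measurable function with $0<p_-:=\operatorname{ess\,inf}_{x}p(x)\le p_+:=\operatorname{ess\,sup}_{x}p(x)<\infty$ that is globally log-Hölder continuous: there are positive constants $C_{\log},C_\infty$ and $p_\infty\in\mathbb R$ with $$|p(x)-p(y)|\le\frac{C_{\log}}{\log(e+1/|x-y|)},\qquad |p(x)-p_\infty|\le\frac{C_\infty}{\log(e+|x|)}\qquad\text{for all }x,y\in\mathbb R^n .$$ For measurable $g$ put $\|g\|_{L^{p(\cdot)}(\mathbb R^n)}:=\inf\{\lambda\in(0,\infty):\int_{\mathbb R^n}(|g(x)|/\lambda)^{p(x)}\,dx\le 1\}$ (with $\inf\emptyset=\infty$). Let $L$ be a densely defined, non-negative, self-adjoint linear operator on $L^2(\mathbb R^n)$ such that the operators $e^{-tL}$, $t>0$, have integral kernels $K_t$ that are measurable functions on $\mathbb R^n\times\mathbb R^n$ and satisfy, for some positive constants $C_1,c,C_2$ and some $\mu\in(0,1]$, for all $t\in(0,\infty)$ and $x,y,y_1,y_2\in\mathbb R^n$, $$|K_t(x,y)|\le\frac{C_1}{t^{n/2}}\exp\Big\{-\frac{|x-y|^2}{ct}\Big\},\qquad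 |K_t(y_1,x)-K_t(y_2,x)|\le\frac{C_2}{t^{n/2}}\,\frac{|y_1-y_2|^\mu}{t^{\mu/2}} .$$ For $f\in L^2(\mathbb R^n)$ and $x\in\mathbb R^n$ set $$f^*_{L,\triangledown}(x):=\sup_{t\in(0,\infty),\,|y-x|<t}\big|e^{-t^2L}(f)(y)\big|,\qquad f^*_{L,+}(x):=\sup_{t\in(0,\infty)}\big|e^{-t^2L}(f)(x)\big|,$$ where $e^{-tL}(f)(y)=\int_{\mathbb R^n}K_t(y,z)f(z)\,dz$. Then there exists a positive constant $C$ such that, for all $f\in L^2(\mathbb R^n)$, $$\|f^*_{L,\triangledown}\|_{L^{p(\cdot)}(\mathbb R^n)}\le C\,\|f^*_{L,+}\|_{L^{p(\cdot)}(\mathbb R^n)} .$$ -/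

import Mathlib

open MeasureTheory Set
open scoped ENNReal NNReal

noncomputable section

/-! ### The heat semigroup of a non-negative self-adjoint operator -/

section HeatSemigroup

variable {H : Type*} [NormedAddCommGroup H] [InnerProductSpace ℂ H] [CompleteSpace H]

/-- `L` is a densely defined, non-negative, self-adjoint (possibly unbounded) operator on `H`. -/
structure IsNonnegSelfAdjoint (L : H →ₗ.[ℂ] H) : Prop where
  dense_domain : Dense (L.domain : Set H)
  selfAdjoint : IsSelfAdjoint L
  nonneg : ∀ u : L.domain, 0 ≤ (inner ℂ (L u) (u : H)).re

/-- `R` is an everywhere defined bounded right inverse of `1 + L`. -/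
def IsResolvent (L : H →ₗ.[ℂ] H) (R : H →L[ℂ] H) : Prop :=
  ∀ u : H, ∃ h : R u ∈ L.domain, R u + L ⟨R u, h⟩ = u

open Classical in
/-- The resolvent `(1 + L)⁻¹`. For non-negative self-adjoint `L` it exists and is unique, see
`IsNonnegSelfAdjoint.existsUnique_isResolvent`. -/
def resolventOp (L : H →ₗ.[ℂ] H) : H →L[ℂ] H :=
  if h : ∃ R, IsResolvent L R then h.choose else 0

/-- The function `s ↦ exp (-t (s⁻¹ - 1))`, extended by `0` to `s ≤ 0`. If `s = (1 + r)⁻¹` with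
`r ≥ 0`, then its value at `s` is `exp (-t r)`. -/
def heatSymbol (t s : ℝ) : ℝ :=
  if s ≤ 0 then 0 else Real.exp (-t * (s⁻¹ - 1))

/-- The operator `e^{-tL}`, `t > 0`, in the functional calculus of a non-negative self-adjoint
operator `L`. Since `e^{-tr} = heatSymbol t ((1 + r)⁻¹)` for `r ≥ 0`, it is obtained by applying
the continuous function `heatSymbol t` to the bounded self-adjoint operator `(1 + L)⁻¹`. -/
def heatSemigroup (L : H →ₗ.[ℂ] H) (t : ℝ) : H →L[ℂ] H :=
  cfc (heatSymbol t) (resolventOp L)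

theorem heatSymbol_inv_one_add (t : ℝ) {r : ℝ} (hr : 0 ≤ r) :
    heatSymbol t (1 + r)⁻¹ = Real.exp (-t * r) := by
  have h : ¬ (1 + r)⁻¹ ≤ 0 := not_le.2 (by positivity)
  rw [heatSymbol, if_neg h, inv_inv, add_sub_cancel_left]

theorem continuous_heatSymbol {t : ℝ} (ht : 0 < t) : Continuous (heatSymbol t) := by
  have h : heatSymbol t = fun s => Real.exp t * expNegInvGlue (s / t) := by
    funext s
    by_cases hs : s ≤ 0
    · rw [heatSymbol, if_pos hs,
        expNegInvGlue.zero_of_nonpos (div_nonpos_of_nonpos_of_nonneg hs ht.le), mul_zero]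
    · have hs' : ¬ s / t ≤ 0 := not_le.2 (div_pos (not_le.1 hs) ht)
      rw [heatSymbol, if_neg hs, expNegInvGlue, if_neg hs', ← Real.exp_add]
      congr 1
      rw [inv_div, div_eq_mul_inv]
      ring
  rw [h]
  exact continuous_const.mul
    ((expNegInvGlue.contDiff (n := 0)).continuous.comp (continuous_id.div_const t))

theorem IsNonnegSelfAdjoint.norm_le {L : H →ₗ.[ℂ] H} (hL : IsNonnegSelfAdjoint L)
    (u : L.domain) : ‖(u : H)‖ ≤ ‖(u : H) + L u‖ := by
  have h1 : ‖(u : H)‖ ^ 2 ≤ (inner ℂ ((u : H) + L u) (u : H)).re := by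
    have h0 : (inner ℂ (u : H) (u : H)).re = ‖(u : H)‖ ^ 2 := inner_self_eq_norm_sq (𝕜 := ℂ) (u : H)
    rw [inner_add_left, Complex.add_re, h0]
    linarith [hL.nonneg u]
  have h2 : (inner ℂ ((u : H) + L u) (u : H)).re ≤ ‖(u : H) + L u‖ * ‖(u : H)‖ :=
    (Complex.re_le_norm _).trans (norm_inner_le_norm _ _)
  by_contra hlt
  push Not at hlt
  have h3 : 0 < ‖(u : H)‖ := (norm_nonneg _).trans_lt hlt
  nlinarith

theorem IsNonnegSelfAdjoint.symm_apply {L : H →ₗ.[ℂ] H} (hL : IsNonnegSelfAdjoint L)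
    (u v : L.domain) : inner ℂ (L u) (v : H) = inner ℂ (u : H) (L v) := by
  have h := LinearPMap.adjoint_isFormalAdjoint hL.dense_domain
  rw [LinearPMap.isSelfAdjoint_def.1 hL.selfAdjoint] at h
  exact h u v

theorem IsNonnegSelfAdjoint.exists_isResolvent {L : H →ₗ.[ℂ] H} (hL : IsNonnegSelfAdjoint L) :
    ∃ R, IsResolvent L R := by
  have hcl : IsClosed (L.graph : Set (H × H)) := hL.selfAdjoint.isClosed
  have : CompleteSpace L.graph := hcl.completeSpace_coe
  let A : L.graph →L[ℂ] H :=
    (ContinuousLinearMap.fst ℂ H H + ContinuousLinearMap.snd ℂ H H).comp L.graph.subtypeL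
  have hA : ∀ g : L.graph, A g = (g : H × H).1 + (g : H × H).2 := fun g => rfl
  have hb : ∀ g : L.graph, ‖g‖ ≤ (2 : ℝ≥0) * ‖A g‖ := by
    intro g
    obtain ⟨u, hu1, hu2⟩ := (LinearPMap.mem_graph_iff L).1 g.2
    have h1 : ‖(g : H × H).1‖ ≤ ‖A g‖ := by
      rw [hA, ← hu1, ← hu2]; exact hL.norm_le u
    have h2 : ‖(g : H × H).2‖ ≤ ‖A g‖ + ‖(g : H × H).1‖ := by
      have : (g : H × H).2 = A g - (g : H × H).1 := by rw [hA]; abel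
      rw [this]; exact norm_sub_le _ _
    have h0 := norm_nonneg (A g)
    change ‖(g : H × H)‖ ≤ _
    rw [Prod.norm_def]
    refine max_le ?_ ?_ <;> push_cast <;> linarith
  have hanti : AntilipschitzWith 2 A := ContinuousLinearMap.antilipschitz_of_bound A hb
  have hker : LinearMap.ker (A : L.graph →ₗ[ℂ] H) = ⊥ :=
    LinearMap.ker_eq_bot.2 hanti.injective
  have hrange : LinearMap.range (A : L.graph →ₗ[ℂ] H) = ⊤ := by
    have hc : IsClosed ((LinearMap.range (A : L.graph →ₗ[ℂ] H) : Submodule ℂ H) : Set H) := by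
      exact hanti.isClosed_range A.uniformContinuous
    have := hc.completeSpace_coe
    rw [← Submodule.orthogonal_eq_bot_iff, Submodule.eq_bot_iff]
    intro z hz
    have hz' : ∀ u : L.domain, inner ℂ (-z) (u : H) = inner ℂ z (L u) := by
      intro u
      have h := (Submodule.mem_orthogonal' _ z).1 hz ((u : H) + L u)
        ⟨⟨((u : H), L u), LinearPMap.mem_graph L u⟩, rfl⟩
      rw [inner_add_right] at h
      rw [inner_neg_left]
      linear_combination -h
    have hmem : z ∈ (LinearPMap.adjoint L).domain :=
      LinearPMap.mem_adjoint_domain_of_exists z ⟨-z, hz'⟩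
    have hval : LinearPMap.adjoint L ⟨z, hmem⟩ = -z :=
      LinearPMap.adjoint_apply_eq hL.dense_domain ⟨z, hmem⟩ hz'
    have hself := LinearPMap.isSelfAdjoint_def.1 hL.selfAdjoint
    have hg : (z, -z) ∈ L.graph := by
      rw [← hself, ← hval]
      exact LinearPMap.mem_graph _ ⟨z, hmem⟩
    obtain ⟨u, hu1, hu2⟩ := (LinearPMap.mem_graph_iff L).1 hg
    have h := hL.norm_le u
    rw [hu2, hu1] at h
    simpa using h
  let e := ContinuousLinearEquiv.ofBijective A hker hrange
  refine ⟨((ContinuousLinearMap.fst ℂ H H).comp L.graph.subtypeL).comp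
    (e.symm : H →L[ℂ] L.graph), fun v => ?_⟩
  have hv : A (e.symm v) = v := e.apply_symm_apply v
  obtain ⟨u, hu1, hu2⟩ := (LinearPMap.mem_graph_iff L).1 (e.symm v).2
  have hu : ((ContinuousLinearMap.fst ℂ H H).comp L.graph.subtypeL).comp
    (e.symm : H →L[ℂ] L.graph) v = (u : H) := hu1.symm
  refine ⟨hu ▸ u.2, ?_⟩
  have : (⟨_, hu ▸ u.2⟩ : L.domain) = u := Subtype.ext hu
  rw [this, hu, hu2]
  rw [hA, ← hu1] at hv
  exact hv

theorem IsNonnegSelfAdjoint.isResolvent_unique {L : H →ₗ.[ℂ] H} (hL : IsNonnegSelfAdjoint L)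
    {R S : H →L[ℂ] H} (hR : IsResolvent L R) (hS : IsResolvent L S) : R = S := by
  ext v
  obtain ⟨h1, e1⟩ := hR v
  obtain ⟨h2, e2⟩ := hS v
  have h := hL.norm_le (⟨R v, h1⟩ - ⟨S v, h2⟩)
  have h0 : ((⟨R v, h1⟩ - ⟨S v, h2⟩ : L.domain) : H) + L (⟨R v, h1⟩ - ⟨S v, h2⟩) = 0 := by
    rw [LinearPMap.map_sub]
    change R v - S v + (L ⟨R v, h1⟩ - L ⟨S v, h2⟩) = 0
    rw [sub_add_sub_comm, e1, e2, sub_self]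
  rw [h0, norm_zero] at h
  exact sub_eq_zero.1 (norm_le_zero_iff.1 h)

theorem IsNonnegSelfAdjoint.existsUnique_isResolvent {L : H →ₗ.[ℂ] H}
    (hL : IsNonnegSelfAdjoint L) : ∃! R, IsResolvent L R :=
  existsUnique_of_exists_of_unique hL.exists_isResolvent
    fun _ _ h1 h2 => hL.isResolvent_unique h1 h2

theorem IsNonnegSelfAdjoint.isResolvent_resolventOp {L : H →ₗ.[ℂ] H}
    (hL : IsNonnegSelfAdjoint L) : IsResolvent L (resolventOp L) := by
  rw [resolventOp, dif_pos hL.exists_isResolvent]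
  exact hL.exists_isResolvent.choose_spec

/-- `(1 + L)⁻¹` is self-adjoint, so the continuous functional calculus applies to it. -/
theorem IsNonnegSelfAdjoint.isSelfAdjoint_resolventOp {L : H →ₗ.[ℂ] H}
    (hL : IsNonnegSelfAdjoint L) : IsSelfAdjoint (resolventOp L) := by
  rw [ContinuousLinearMap.isSelfAdjoint_iff_isSymmetric]
  intro u v
  obtain ⟨hu, eu⟩ := hL.isResolvent_resolventOp u
  obtain ⟨hv, ev⟩ := hL.isResolvent_resolventOp v
  have h := hL.symm_apply ⟨_, hu⟩ ⟨_, hv⟩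
  change inner ℂ (resolventOp L u) v = inner ℂ u (resolventOp L v)
  conv_lhs => rw [← ev]
  conv_rhs => rw [← eu]
  rw [inner_add_left, inner_add_right, h]

end HeatSemigroup

/-! ### Heat kernels on `ℝⁿ` -/

/-- The complex Hilbert space `L²(ℝⁿ)`. -/
abbrev L2Space (n : ℕ) : Type :=
  Lp ℂ 2 (volume : Measure (EuclideanSpace ℝ (Fin n)))

/-- The family `K` consists of measurable functions and `K t` is the integral kernel of `e^{-tL}`,
for every `t > 0`. -/
structure IsHeatKernel {n : ℕ} (L : L2Space n →ₗ.[ℂ] L2Space n)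
    (K : ℝ → EuclideanSpace ℝ (Fin n) → EuclideanSpace ℝ (Fin n) → ℂ) : Prop where
  measurable : ∀ t : ℝ, 0 < t → Measurable (Function.uncurry (K t))
  ae_eq : ∀ t : ℝ, 0 < t → ∀ f : L2Space n,
    ∀ᵐ x, heatSemigroup L t f x = ∫ y, K t x y * f y

/-- The Gaussian upper bound for the kernels. -/
def HasGaussianBound {n : ℕ}
    (K : ℝ → EuclideanSpace ℝ (Fin n) → EuclideanSpace ℝ (Fin n) → ℂ) : Prop :=
  ∃ C c : ℝ, 0 < C ∧ 0 < c ∧ ∀ t : ℝ, 0 < t → ∀ x y,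
    ‖K t x y‖ ≤ C / t ^ ((n : ℝ) / 2) * Real.exp (-(‖x - y‖ ^ 2 / (c * t)))

/-- The Hölder continuity of the kernels in the first variable. -/
def HasHolderBound {n : ℕ}
    (K : ℝ → EuclideanSpace ℝ (Fin n) → EuclideanSpace ℝ (Fin n) → ℂ) : Prop :=
  ∃ C μ : ℝ, 0 < C ∧ 0 < μ ∧ μ ≤ 1 ∧ ∀ t : ℝ, 0 < t → ∀ x y₁ y₂,
    ‖K t y₁ x - K t y₂ x‖ ≤ C / t ^ ((n : ℝ) / 2) * (‖y₁ - y₂‖ ^ μ / t ^ (μ / 2))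

/-! ### Maximal functions -/

/-- The value `e^{-tL}(f)(y)`, where `K` is the heat kernel of `L`. -/
def heatValue {n : ℕ} (K : ℝ → EuclideanSpace ℝ (Fin n) → EuclideanSpace ℝ (Fin n) → ℂ)
    (f : L2Space n) (t : ℝ) (y : EuclideanSpace ℝ (Fin n)) : ℂ :=
  ∫ z, K t y z * f z

/-- The non-tangential maximal function `sup_{t > 0, |y - x| < t} |e^{-t²L}(f)(y)|`. -/
def nontangentialMax {n : ℕ} (K : ℝ → EuclideanSpace ℝ (Fin n) → EuclideanSpace ℝ (Fin n) → ℂ)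
    (f : L2Space n) (x : EuclideanSpace ℝ (Fin n)) : ℝ≥0∞ :=
  ⨆ (t : ℝ) (_ : 0 < t) (y : EuclideanSpace ℝ (Fin n)) (_ : ‖y - x‖ < t),
    ‖heatValue K f (t ^ 2) y‖ₑ

/-- The radial maximal function `sup_{t > 0} |e^{-t²L}(f)(x)|`. -/
def radialMax {n : ℕ} (K : ℝ → EuclideanSpace ℝ (Fin n) → EuclideanSpace ℝ (Fin n) → ℂ)
    (f : L2Space n) (x : EuclideanSpace ℝ (Fin n)) : ℝ≥0∞ :=
  ⨆ (t : ℝ) (_ : 0 < t), ‖heatValue K f (t ^ 2) x‖ₑ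

/-! ### Variable exponent Lebesgue spaces -/

/-- A measurable function `p : ℝⁿ → (0, ∞)` with `0 < ess inf p` and `ess sup p < ∞`. -/
structure IsVariableExponent {n : ℕ} (p : EuclideanSpace ℝ (Fin n) → ℝ) : Prop where
  measurable : Measurable p
  pos : ∀ x, 0 < p x
  essInf_pos : 0 < essInf (fun x => (p x : EReal)) volume
  essSup_lt_top : essSup (fun x => (p x : EReal)) volume < ⊤

/-- The globally log-Hölder continuous condition. For `x = y` the left side of the first
inequality vanishes. -/
structure IsGloballyLogHolder {n : ℕ} (p : EuclideanSpace ℝ (Fin n) → ℝ) : Prop where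
  locally_log : ∃ C : ℝ, 0 < C ∧ ∀ x y,
    |p x - p y| ≤ C / Real.log (Real.exp 1 + 1 / ‖x - y‖)
  at_infinity : ∃ C pinf : ℝ, 0 < C ∧ ∀ x,
    |p x - pinf| ≤ C / Real.log (Real.exp 1 + ‖x‖)

/-- The modular `∫ g(x)^{p(x)} dx` of a `[0, ∞]`-valued function. -/
def modular {n : ℕ} (p : EuclideanSpace ℝ (Fin n) → ℝ)
    (g : EuclideanSpace ℝ (Fin n) → ℝ≥0∞) : ℝ≥0∞ :=
  ∫⁻ x, g x ^ p x

/-- The Luxemburg quasi-norm in `L^{p(·)}(ℝⁿ)`, with value `∞` if there is no admissible `r`. -/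
def luxemburgNorm {n : ℕ} (p : EuclideanSpace ℝ (Fin n) → ℝ)
    (g : EuclideanSpace ℝ (Fin n) → ℝ≥0∞) : ℝ≥0∞ :=
  sInf {r : ℝ≥0∞ | 0 < r ∧ r < ∞ ∧ modular p (fun x => g x / r) ≤ 1}

end

/-! Write `u(t, y)` for the value of `e^{-t²L} f` at `y`, `M` for the Hardy-Littlewood maximal
operator, and fix `m > 0` with `m ≤ p` everywhere. The proof combines a pointwise bound with a bound
for `M` in variable exponent spaces, both used with `r = m / 2`.

Pointwise (`exists_nontangentialMax_le`): the non-tangential function at `x` is at most a constant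
times `M((f*₊)^r)(x)^{1/r}`, for any `r > 0`. Let `F` be the supremum of `|u(t, y)| / W(t, y)` with
the tangential weight `W = (1 + |x - y|/t)^N (1 + ε/t)^N`. By the semigroup law, `u(t, ·)` arises
from `u(t/√2, ·)` by a kernel that is Hölder continuous with Gaussian decay. Hence `u(t, ·)`
oscillates by at most `F W / 2` on the ball of radius `δt` about `y`, once `δ` is small. There
`|u(t, y)| - F W / 2 ≤ f*₊`, and averaging `r`-th powers gives `F ≤ X + F / 2`, where `X` is the
wanted right side up to a constant. The factor with `ε` makes `F` finite, so `F ≤ 2X`; the bound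
does not depend on `ε`, and `ε = t` finishes.

Maximal operator (`exists_modular_ballMax_le`): put `s = p / m ≥ 1`. Log-Hölder continuity yields
`(M h)^s ≤ C (M(h^s) + M w + w)` with `w(x) = (e + |x|)⁻ⁿ`, whenever `h^s` lies in the unit ball of
`L²`. The `L²` bound for `M` then controls `∫ (M h)^{2s}`, because `w` is in `L²`. With `h =
g^{m/2}` this is a modular bound with exponent `2s · m/2 = p`. -/

/-! ### The Hardy-Littlewood maximal function -/

section Maximal

open Metric

variable {n : ℕ}

/-- The uncentered Hardy-Littlewood maximal function of a `[0, ∞]`-valued function. -/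
noncomputable def ballMax (g : EuclideanSpace ℝ (Fin n) → ℝ≥0∞) (x : EuclideanSpace ℝ (Fin n)) :
    ℝ≥0∞ :=
  ⨆ (c : EuclideanSpace ℝ (Fin n)) (ρ : ℝ) (_ : x ∈ ball c ρ), ⨍⁻ y in ball c ρ, g y ∂volume

theorem laverage_le_ballMax (g : EuclideanSpace ℝ (Fin n) → ℝ≥0∞)
    {x c : EuclideanSpace ℝ (Fin n)} {ρ : ℝ} (hx : x ∈ ball c ρ) :
    ⨍⁻ y in ball c ρ, g y ∂volume ≤ ballMax g x :=
  le_iSup_of_le c (le_iSup_of_le ρ (le_iSup_of_le hx le_rfl))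

theorem ballMax_le_iff {g : EuclideanSpace ℝ (Fin n) → ℝ≥0∞} {x : EuclideanSpace ℝ (Fin n)}
    {a : ℝ≥0∞} :
    ballMax g x ≤ a ↔ ∀ c ρ, x ∈ ball c ρ → ⨍⁻ y in ball c ρ, g y ∂volume ≤ a := by
  simp only [ballMax, iSup_le_iff]

theorem lt_ballMax_iff {g : EuclideanSpace ℝ (Fin n) → ℝ≥0∞} {x : EuclideanSpace ℝ (Fin n)}
    {a : ℝ≥0∞} :
    a < ballMax g x ↔ ∃ c ρ, x ∈ ball c ρ ∧ a < ⨍⁻ y in ball c ρ, g y ∂volume := by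
  simp only [ballMax, lt_iSup_iff, exists_prop]

theorem isOpen_lt_ballMax (g : EuclideanSpace ℝ (Fin n) → ℝ≥0∞) (a : ℝ≥0∞) :
    IsOpen {x | a < ballMax g x} := by
  rw [Metric.isOpen_iff]
  intro x hx
  obtain ⟨c, ρ, hxc, h⟩ := lt_ballMax_iff.1 hx
  obtain ⟨ε, hε, hb⟩ := Metric.isOpen_iff.1 (isOpen_ball (x := c) (ε := ρ)) x hxc
  exact ⟨ε, hε, fun y hy => lt_ballMax_iff.2 ⟨c, ρ, hb hy, h⟩⟩

theorem measurable_ballMax (g : EuclideanSpace ℝ (Fin n) → ℝ≥0∞) : Measurable (ballMax g) :=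
  measurable_of_Ioi fun a => (isOpen_lt_ballMax g a).measurableSet

/-- The weak type `(1, 1)` inequality. -/
theorem mul_volume_lt_ballMax_le (hn : 0 < n) (g : EuclideanSpace ℝ (Fin n) → ℝ≥0∞)
    {a : ℝ≥0∞} (ha : a ≠ 0) (ha' : a ≠ ∞) :
    a * volume {x | a < ballMax g x} ≤ 4 ^ n * ∫⁻ x, g x := by
  have : Nonempty (Fin n) := ⟨⟨0, hn⟩⟩
  rcases eq_or_ne (∫⁻ x, g x) ∞ with hI | hI
  · rw [hI, ENNReal.mul_top (by positivity)]; exact le_top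
  have hvol : ∀ (c : EuclideanSpace ℝ (Fin n)) {ρ : ℝ}, 0 < ρ →
      volume (ball c ρ) = ENNReal.ofReal (ρ ^ n) * volume (ball (0 : EuclideanSpace ℝ (Fin n)) 1) := by
    intro c ρ hρ
    rw [Measure.addHaar_ball_of_pos _ c hρ, finrank_euclideanSpace_fin]
  set V := volume (ball (0 : EuclideanSpace ℝ (Fin n)) 1) with hV
  have hV0 : V ≠ 0 := (measure_ball_pos _ _ one_pos).ne'
  have hVt : V ≠ ∞ := measure_ball_lt_top.ne
  let T : Set (EuclideanSpace ℝ (Fin n) × ℝ) :=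
    {q | 0 < q.2 ∧ a * volume (ball q.1 q.2) ≤ ∫⁻ y in ball q.1 q.2, g y}
  have hcov : {x | a < ballMax g x} ⊆ ⋃ q ∈ T, ball q.1 q.2 := by
    intro x hx
    obtain ⟨c, ρ, hxc, h⟩ := lt_ballMax_iff.1 hx
    have hρ : 0 < ρ := pos_of_mem_ball hxc
    refine mem_biUnion (x := (c, ρ)) ⟨hρ, ?_⟩ hxc
    rw [setLAverage_eq] at h
    exact ENNReal.mul_le_of_le_div h.le
  -- Vitali's lemma needs bounded radii. Here `ρ ^ n` is bounded because `g` has finite integral,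
  -- and `n > 0` turns this into a bound on `ρ`.
  have hrad : ∀ q ∈ T, q.2 ≤ 1 + ((∫⁻ x, g x) / (a * V)).toReal := by
    rintro ⟨c, ρ⟩ ⟨hρ, h⟩
    simp only at hρ h ⊢
    have h1 : ENNReal.ofReal (ρ ^ n) ≤ (∫⁻ x, g x) / (a * V) := by
      rw [ENNReal.le_div_iff_mul_le (Or.inl (mul_ne_zero ha hV0))
        (Or.inl (ENNReal.mul_ne_top ha' hVt))]
      rw [hvol c hρ] at h
      calc ENNReal.ofReal (ρ ^ n) * (a * V) = a * (ENNReal.ofReal (ρ ^ n) * V) := by ring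
        _ ≤ _ := h.trans (setLIntegral_le_lintegral _ _)
    have h2 : (∫⁻ x, g x) / (a * V) ≠ ∞ := ENNReal.div_ne_top hI (mul_ne_zero ha hV0)
    have h3 : ρ ^ n ≤ ((∫⁻ x, g x) / (a * V)).toReal := (ENNReal.ofReal_le_iff_le_toReal h2).1 h1
    rcases le_total ρ 1 with h4 | h4
    · linarith [ENNReal.toReal_nonneg (a := (∫⁻ x, g x) / (a * V))]
    · linarith [le_self_pow₀ h4 hn.ne']
  obtain ⟨u, huT, hdisj, hu⟩ := Vitali.exists_disjoint_subfamily_covering_enlargement_ball T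
    (fun q => q.1) (fun q => q.2) _ hrad 4 (by norm_num)
  have hcount : u.Countable :=
    hdisj.countable_of_isOpen (fun q _ => isOpen_ball)
      (fun q hq => nonempty_ball.2 (huT hq).1)
  have hcov2 : {x | a < ballMax g x} ⊆ ⋃ q ∈ u, ball q.1 (4 * q.2) := by
    intro x hx
    obtain ⟨q, hq, hxq⟩ := mem_iUnion₂.1 (hcov hx)
    obtain ⟨b, hb, hsub⟩ := hu q hq
    exact mem_biUnion hb (hsub hxq)
  have := hcount.to_subtype
  calc a * volume {x | a < ballMax g x}
      ≤ a * ∑' q : u, volume (ball q.1.1 (4 * q.1.2)) := by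
        gcongr
        exact (measure_mono hcov2).trans (measure_biUnion_le _ hcount _)
    _ = ∑' q : u, a * volume (ball q.1.1 (4 * q.1.2)) := ENNReal.tsum_mul_left.symm
    _ ≤ ∑' q : u, 4 ^ n * ∫⁻ y in ball q.1.1 q.1.2, g y := by
        refine ENNReal.tsum_le_tsum fun q => ?_
        obtain ⟨h0, h1⟩ := huT q.2
        rw [hvol _ (by linarith), mul_pow, ENNReal.ofReal_mul (by positivity)]
        rw [hvol _ h0] at h1
        calc a * (ENNReal.ofReal (4 ^ n) * ENNReal.ofReal (q.1.2 ^ n) * V)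
            = 4 ^ n * (a * (ENNReal.ofReal (q.1.2 ^ n) * V)) := by
              rw [ENNReal.ofReal_pow (by norm_num), ENNReal.ofReal_ofNat]; ring
          _ ≤ _ := by gcongr
    _ = 4 ^ n * ∫⁻ y in ⋃ q ∈ u, ball q.1 q.2, g y := by
        rw [ENNReal.tsum_mul_left, lintegral_biUnion hcount (fun q _ => measurableSet_ball) hdisj]
    _ ≤ 4 ^ n * ∫⁻ x, g x := by exact mul_le_mul_right (setLIntegral_le_lintegral _ _) _

theorem ballMax_le_ballMax_add {g k : EuclideanSpace ℝ (Fin n) → ℝ≥0∞} {a : ℝ≥0∞}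
    (h : ∀ x, g x ≤ k x + a) (x : EuclideanSpace ℝ (Fin n)) :
    ballMax g x ≤ ballMax k x + a := by
  refine ballMax_le_iff.2 fun c ρ hx => ?_
  have hρ : 0 < ρ := pos_of_mem_ball hx
  refine le_trans ?_ (add_le_add_left (laverage_le_ballMax k hx) a)
  calc ⨍⁻ y in ball c ρ, g y ∂volume ≤ ⨍⁻ y in ball c ρ, (k y + a) ∂volume := lintegral_mono h
    _ = _ := by
      rw [setLAverage_eq, setLAverage_eq, lintegral_add_right _ measurable_const,
        ENNReal.add_div, setLIntegral_const,
        ENNReal.mul_div_cancel_right (measure_ball_pos _ _ hρ).ne' measure_ball_lt_top.ne]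

/-- The part of `g` below `a / 2` contributes at most `a / 2` to any average, so the weak type bound
is needed only for the part above. The factor `2 * a` is the density in the layer cake formula for
squares. -/
theorem volume_lt_ballMax_le (hn : 0 < n) (g : EuclideanSpace ℝ (Fin n) → ℝ≥0∞)
    {a : ℝ} (ha : 0 < a) :
    ENNReal.ofReal (2 * a) * volume {x | ENNReal.ofReal a < ballMax g x} ≤
      4 * 4 ^ n * ∫⁻ x, {x | ENNReal.ofReal (a / 2) < g x}.indicator g x := by
  set k := {x | ENNReal.ofReal (a / 2) < g x}.indicator g with hk
  have hsub : {x | ENNReal.ofReal a < ballMax g x} ⊆ {x | ENNReal.ofReal (a / 2) < ballMax k x} := by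
    intro x hx
    have h := ballMax_le_ballMax_add (g := g) (k := k) (a := ENNReal.ofReal (a / 2)) (fun y => by
      by_cases hy : y ∈ {x | ENNReal.ofReal (a / 2) < g x}
      · rw [hk, indicator_of_mem hy]; exact le_self_add
      · rw [hk, indicator_of_notMem hy, zero_add]; exact not_lt.1 hy) x
    by_contra hc
    have hc' : ballMax k x ≤ ENNReal.ofReal (a / 2) := not_lt.1 hc
    have : ballMax g x ≤ ENNReal.ofReal a := by
      refine (h.trans (add_le_add_left hc' _)).trans_eq ?_
      rw [← ENNReal.ofReal_add (by positivity) (by positivity), add_halves]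
    exact absurd hx (not_lt.2 this)
  have hw := mul_volume_lt_ballMax_le hn k (a := ENNReal.ofReal (a / 2))
    (by simpa using ha) ENNReal.ofReal_ne_top
  calc ENNReal.ofReal (2 * a) * volume {x | ENNReal.ofReal a < ballMax g x}
      ≤ ENNReal.ofReal (2 * a) * volume {x | ENNReal.ofReal (a / 2) < ballMax k x} := by gcongr
    _ = 4 * (ENNReal.ofReal (a / 2) * volume {x | ENNReal.ofReal (a / 2) < ballMax k x}) := by
        rw [show 2 * a = 4 * (a / 2) by ring, ENNReal.ofReal_mul (by norm_num),
          ENNReal.ofReal_ofNat, mul_assoc]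
    _ ≤ _ := by rw [mul_assoc]; gcongr

theorem sq_le_lintegral_indicator (b : ℝ≥0∞) :
    b ^ 2 ≤ ∫⁻ a in Ioi (0 : ℝ), {a : ℝ | ENNReal.ofReal a < b}.indicator
      (fun a => ENNReal.ofReal (2 * a)) a := by
  have key : ∀ c : ℝ, 0 ≤ c → ENNReal.ofReal c ≤ b → ENNReal.ofReal (c ^ 2) ≤
      ∫⁻ a in Ioi (0 : ℝ), {a : ℝ | ENNReal.ofReal a < b}.indicator
        (fun a => ENNReal.ofReal (2 * a)) a := by
    intro c hc hcb
    have h1 : ∫ a in (0 : ℝ)..c, 2 * a = c ^ 2 := by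
      rw [intervalIntegral.integral_const_mul, integral_id]; ring
    have h2 : ENNReal.ofReal (c ^ 2) = ∫⁻ a in Ioo 0 c, ENNReal.ofReal (2 * a) := by
      rw [← h1, intervalIntegral.integral_of_le hc, ofReal_integral_eq_lintegral_ofReal]
      · exact (setLIntegral_congr Ioo_ae_eq_Ioc).symm
      · exact (Continuous.integrableOn_Icc (by fun_prop)).mono_set Ioc_subset_Icc_self
      · exact (ae_restrict_iff' measurableSet_Ioc).2 (ae_of_all _ fun x hx => by
          have := hx.1; simp only [Pi.zero_apply]; linarith)
    rw [h2]
    calc ∫⁻ a in Ioo 0 c, ENNReal.ofReal (2 * a)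
        = ∫⁻ a in Ioo 0 c, {a : ℝ | ENNReal.ofReal a < b}.indicator
            (fun a => ENNReal.ofReal (2 * a)) a := by
          refine setLIntegral_congr_fun measurableSet_Ioo fun a ha => ?_
          rw [indicator_of_mem]
          exact ((ENNReal.ofReal_lt_ofReal_iff (ha.1.trans ha.2)).2 ha.2).trans_le hcb
      _ ≤ _ := lintegral_mono_set (fun a ha => ha.1)
  rcases eq_or_ne b ∞ with hb | hb
  · subst hb
    rw [ENNReal.top_pow two_ne_zero, top_le_iff]
    refine ENNReal.eq_top_of_forall_nnreal_le fun r => ?_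
    have h := key (r + 1) (by positivity) le_top
    refine le_trans ?_ h
    rw [← ENNReal.ofReal_coe_nnreal]
    refine ENNReal.ofReal_le_ofReal ?_
    nlinarith [r.2]
  · have h := key b.toReal ENNReal.toReal_nonneg (ENNReal.ofReal_toReal hb).le
    rwa [ENNReal.ofReal_pow ENNReal.toReal_nonneg, ENNReal.ofReal_toReal hb] at h

/-- The strong type `(2, 2)` inequality. -/
theorem lintegral_ballMax_sq_le (hn : 0 < n) {g : EuclideanSpace ℝ (Fin n) → ℝ≥0∞}
    (hg : Measurable g) :
    ∫⁻ x, ballMax g x ^ 2 ≤ 8 * 4 ^ n * ∫⁻ x, g x ^ 2 := by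
  have hmeas1 : Measurable (Function.uncurry fun (x : EuclideanSpace ℝ (Fin n)) (a : ℝ) =>
      {a : ℝ | ENNReal.ofReal a < ballMax g x}.indicator (fun a => ENNReal.ofReal (2 * a)) a) := by
    have hs : MeasurableSet {q : EuclideanSpace ℝ (Fin n) × ℝ |
        ENNReal.ofReal q.2 < ballMax g q.1} :=
      measurableSet_lt (ENNReal.measurable_ofReal.comp measurable_snd)
        ((measurable_ballMax g).comp measurable_fst)
    exact Measurable.indicator (f := fun q : EuclideanSpace ℝ (Fin n) × ℝ =>
      ENNReal.ofReal (2 * q.2)) (by fun_prop) hs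
  have hmeas2 : Measurable (Function.uncurry fun (a : ℝ) (x : EuclideanSpace ℝ (Fin n)) =>
      {x | ENNReal.ofReal (a / 2) < g x}.indicator g x) := by
    have hs : MeasurableSet {q : ℝ × EuclideanSpace ℝ (Fin n) |
        ENNReal.ofReal (q.1 / 2) < g q.2} :=
      measurableSet_lt (by fun_prop) (hg.comp measurable_snd)
    exact Measurable.indicator (f := fun q : ℝ × EuclideanSpace ℝ (Fin n) => g q.2)
      (hg.comp measurable_snd) hs
  -- Marcinkiewicz interpolation by hand: layer cake, the truncated weak type bound at each height,
  -- then Tonelli. At `x` only the heights `a < 2 * g x` survive, which gives `2 * g x ^ 2`.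
  calc ∫⁻ x, ballMax g x ^ 2
      ≤ ∫⁻ x, ∫⁻ a in Ioi (0 : ℝ), {a : ℝ | ENNReal.ofReal a < ballMax g x}.indicator
          (fun a => ENNReal.ofReal (2 * a)) a := lintegral_mono fun x => sq_le_lintegral_indicator _
    _ = ∫⁻ a in Ioi (0 : ℝ), ∫⁻ x, {a : ℝ | ENNReal.ofReal a < ballMax g x}.indicator
          (fun a => ENNReal.ofReal (2 * a)) a := lintegral_lintegral_swap hmeas1.aemeasurable
    _ = ∫⁻ a in Ioi (0 : ℝ), ENNReal.ofReal (2 * a) *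
          volume {x | ENNReal.ofReal a < ballMax g x} := by
        refine lintegral_congr fun a => ?_
        rw [← lintegral_indicator_const (isOpen_lt_ballMax g _).measurableSet]
        rfl
    _ ≤ ∫⁻ a in Ioi (0 : ℝ), 4 * 4 ^ n *
          ∫⁻ x, {x | ENNReal.ofReal (a / 2) < g x}.indicator g x :=
        setLIntegral_mono' measurableSet_Ioi fun a ha => volume_lt_ballMax_le hn g ha
    _ = 4 * 4 ^ n * ∫⁻ a in Ioi (0 : ℝ),
          ∫⁻ x, {x | ENNReal.ofReal (a / 2) < g x}.indicator g x :=
        lintegral_const_mul' _ _ (by finiteness)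
    _ = 4 * 4 ^ n * ∫⁻ x, ∫⁻ a in Ioi (0 : ℝ),
          {x | ENNReal.ofReal (a / 2) < g x}.indicator g x := by
        rw [lintegral_lintegral_swap hmeas2.aemeasurable]
    _ ≤ 4 * 4 ^ n * ∫⁻ x, 2 * g x ^ 2 := by
        gcongr with x
        rcases eq_or_ne (g x) ∞ with hx | hx
        · simp [hx]
        calc ∫⁻ a in Ioi (0 : ℝ), {x | ENNReal.ofReal (a / 2) < g x}.indicator g x
            ≤ ∫⁻ a in Ioi (0 : ℝ), (Iio (2 * (g x).toReal)).indicator (fun _ => g x) a := by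
              refine setLIntegral_mono' measurableSet_Ioi fun a ha => ?_
              by_cases h : ENNReal.ofReal (a / 2) < g x
              · have h1 := (ENNReal.ofReal_lt_iff_lt_toReal (half_pos ha).le hx).1 h
                have h2 : a ∈ Iio (2 * (g x).toReal) := by rw [mem_Iio]; linarith
                rw [indicator_of_mem h2]
                exact indicator_le_self _ _ _
              · rw [indicator_of_notMem (by exact h)]; exact zero_le
          _ ≤ g x * volume (Ioo 0 (2 * (g x).toReal)) := by
              rw [lintegral_indicator_const measurableSet_Iio,
                Measure.restrict_apply measurableSet_Iio, inter_comm, Ioi_inter_Iio]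
          _ = 2 * g x ^ 2 := by
              rw [Real.volume_Ioo, sub_zero, ENNReal.ofReal_mul (by norm_num),
                ENNReal.ofReal_toReal hx, ENNReal.ofReal_ofNat]
              ring
    _ = 8 * 4 ^ n * ∫⁻ x, g x ^ 2 := by
        rw [lintegral_const_mul' _ _ (by finiteness)]; ring

end Maximal

/-! ### The maximal function on variable exponent spaces -/

section VariableExponent

open Metric

variable {n : ℕ}

/-! ### Jensen's inequality and comparison of powers with nearby exponents -/

theorem rpow_lintegral_le_lintegral_rpow {α : Type*} [MeasurableSpace α] (μ : Measure α)
    [IsProbabilityMeasure μ] {f : α → ℝ≥0∞} (hf : AEMeasurable f μ) {a : ℝ} (ha : 1 ≤ a) :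
    (∫⁻ x, f x ∂μ) ^ a ≤ ∫⁻ x, f x ^ a ∂μ := by
  have h := eLpNorm'_le_eLpNorm'_of_exponent_le one_pos ha μ hf.aestronglyMeasurable
  simp only [eLpNorm', enorm_eq_self, ENNReal.rpow_one, one_div, inv_one] at h
  exact (ENNReal.le_rpow_inv_iff (by linarith)).1 h

theorem rpow_laverage_ball_le (c : EuclideanSpace ℝ (Fin n)) {ρ : ℝ} (hρ : 0 < ρ)
    {f : EuclideanSpace ℝ (Fin n) → ℝ≥0∞} (hf : Measurable f) {a : ℝ} (ha : 1 ≤ a) :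
    (⨍⁻ y in ball c ρ, f y ∂volume) ^ a ≤ ⨍⁻ y in ball c ρ, f y ^ a ∂volume := by
  have : IsProbabilityMeasure
      ((volume.restrict (ball c ρ) univ)⁻¹ • volume.restrict (ball c ρ)) := by
    refine ⟨?_⟩
    rw [Measure.smul_apply, smul_eq_mul, Measure.restrict_apply_univ]
    exact ENNReal.inv_mul_cancel (measure_ball_pos _ _ hρ).ne' measure_ball_lt_top.ne
  exact rpow_lintegral_le_lintegral_rpow _ hf.aemeasurable ha

/-- The log-Hölder modulus is exactly the one for which a power of `t`, raised to an exponent error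
`A / log t`, stays constant. -/
theorem rpow_div_log_eq {t A : ℝ} (ht : Real.exp 1 ≤ t) (n : ℕ) :
    (t ^ n) ^ (A / Real.log t) = Real.exp (n * A) := by
  have h0 : 0 < t := (Real.exp_pos 1).trans_le ht
  have h1 : 1 ≤ Real.log t := by
    rw [← Real.log_exp 1]; exact Real.log_le_log (Real.exp_pos 1) ht
  rw [Real.rpow_def_of_pos (by positivity), Real.log_pow]
  congr 1
  field_simp

/-- For `a ≤ 1` a larger exponent only decreases the power. For `a ≥ 1` one has `a ≤ a ^ 2 ≤ κ * t ^
n`, so the excess power is bounded by `rpow_div_log_eq`. -/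
theorem rpow_le_mul_of_sq_le {a : ℝ≥0∞} {κ t A σ : ℝ} (hκ : 1 ≤ κ) (ht : Real.exp 1 ≤ t)
    (hA : 0 ≤ A) (ha : a ^ 2 ≤ ENNReal.ofReal (κ * t ^ n)) (hσ1 : 1 ≤ σ)
    (hσ : σ ≤ 1 + A / Real.log t) :
    a ^ σ ≤ ENNReal.ofReal (κ ^ A * Real.exp (n * A)) * a := by
  have h0 : 0 < t := (Real.exp_pos 1).trans_le ht
  have h1 : 1 ≤ Real.log t := by
    rw [← Real.log_exp 1]; exact Real.log_le_log (Real.exp_pos 1) ht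
  have hat : a ≠ ∞ := by
    rintro rfl
    simp at ha
  lift a to ℝ≥0 using hat
  obtain ⟨b, hb⟩ : ∃ b : ℝ, b = a := ⟨_, rfl⟩
  have hb0 : 0 ≤ b := hb ▸ a.2
  have hab : (a : ℝ≥0∞) = ENNReal.ofReal b := by rw [hb, ENNReal.ofReal_coe_nnreal]
  rw [hab] at ha ⊢
  rw [← ENNReal.ofReal_pow hb0, ENNReal.ofReal_le_ofReal_iff (by positivity)] at ha
  rw [ENNReal.ofReal_rpow_of_nonneg hb0 (by linarith), ← ENNReal.ofReal_mul (by positivity)]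
  refine ENNReal.ofReal_le_ofReal ?_
  rcases le_total b 1 with hb1 | hb1
  · calc b ^ σ ≤ b ^ (1 : ℝ) := Real.rpow_le_rpow_of_exponent_ge' hb0 hb1 zero_le_one hσ1
      _ = 1 * 1 * b := by rw [Real.rpow_one]; ring
      _ ≤ _ := by
        gcongr
        · exact Real.one_le_rpow hκ hA
        · exact Real.one_le_exp (by positivity)
  · have hbk : b ≤ κ * t ^ n := (le_self_pow₀ hb1 two_ne_zero).trans ha
    calc b ^ σ = b ^ (σ - 1) * b := by
          rw [← Real.rpow_add_one (by linarith)]; congr 1; ring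
      _ ≤ b ^ (A / Real.log t) * b := by
          gcongr ?_ * _
          exact Real.rpow_le_rpow_of_exponent_le hb1 (by linarith)
      _ ≤ (κ * t ^ n) ^ (A / Real.log t) * b := by gcongr
      _ = κ ^ (A / Real.log t) * Real.exp (n * A) * b := by
          rw [Real.mul_rpow (by linarith) (by positivity), rpow_div_log_eq ht]
      _ ≤ _ := by
          gcongr ?_ * _ * _
          exact Real.rpow_le_rpow_of_exponent_le hκ (div_le_self hA h1)

/-- If `α` is below `t⁻ⁿ`, so is `α ^ a`, since `a ≥ 1`. Otherwise `α⁻¹ ≤ tⁿ`, and changing the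
exponent costs only a constant. -/
theorem rpow_le_mul_rpow_add {α : ℝ≥0∞} (hα : α ≤ 1) {t A a b : ℝ} (ht : Real.exp 1 ≤ t)
    (ha : 1 ≤ a) (hb : 1 ≤ b) (hab : |a - b| ≤ A / Real.log t) :
    α ^ a ≤ ENNReal.ofReal (Real.exp (n * A)) * α ^ b + ENNReal.ofReal ((t ^ n)⁻¹) := by
  have h0 : 0 < t := (Real.exp_pos 1).trans_le ht
  have hαt : α ≠ ∞ := (hα.trans_lt ENNReal.one_lt_top).ne
  lift α to ℝ≥0 using hαt
  obtain ⟨x, hx⟩ : ∃ x : ℝ, x = α := ⟨_, rfl⟩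
  have hx0 : 0 ≤ x := hx ▸ α.2
  have hxa : (α : ℝ≥0∞) = ENNReal.ofReal x := by rw [hx, ENNReal.ofReal_coe_nnreal]
  have hx1 : x ≤ 1 := by rw [hx]; exact_mod_cast hα
  rw [hxa, ENNReal.ofReal_rpow_of_nonneg hx0 (by linarith),
    ENNReal.ofReal_rpow_of_nonneg hx0 (by linarith), ← ENNReal.ofReal_mul (by positivity),
    ← ENNReal.ofReal_add (by positivity) (by positivity)]
  refine ENNReal.ofReal_le_ofReal ?_
  rcases le_total x (t ^ n)⁻¹ with hxt | hxt
  · have : x ^ a ≤ x ^ (1 : ℝ) := Real.rpow_le_rpow_of_exponent_ge' hx0 hx1 zero_le_one ha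
    rw [Real.rpow_one] at this
    have : 0 ≤ Real.exp (n * A) * x ^ b := by positivity
    linarith
  · have hx0' : 0 < x := lt_of_lt_of_le (by positivity) hxt
    have h2 : x ^ a ≤ Real.exp (n * A) * x ^ b := by
      calc x ^ a = x ^ (a - b) * x ^ b := by rw [← Real.rpow_add hx0']; congr 1; ring
        _ ≤ x ^ (-(A / Real.log t)) * x ^ b := by
          gcongr ?_ * _
          exact Real.rpow_le_rpow_of_exponent_ge hx0' hx1 (by linarith [(abs_le.1 hab).1])
        _ = (x⁻¹) ^ (A / Real.log t) * x ^ b := by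
          rw [Real.rpow_neg hx0, Real.inv_rpow hx0]
        _ ≤ (t ^ n) ^ (A / Real.log t) * x ^ b := by
          gcongr
          · exact (abs_nonneg _).trans hab
          · exact inv_le_of_inv_le₀ (by positivity) hxt
        _ = _ := by rw [rpow_div_log_eq ht]
    have : 0 ≤ (t ^ n)⁻¹ := by positivity
    linarith

/-- The weight `(e + |x|)⁻ⁿ`. -/
noncomputable def decayWeight (x : EuclideanSpace ℝ (Fin n)) : ℝ≥0∞ :=
  ENNReal.ofReal (((Real.exp 1 + ‖x‖) ^ n)⁻¹)

theorem measurable_decayWeight : Measurable (decayWeight (n := n)) := by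
  unfold decayWeight; fun_prop

/-- The square decays like `|x|^(-2n)`. The weight itself is not integrable, which is why the
argument runs in `L²`. -/
theorem lintegral_decayWeight_sq_lt_top (hn : 0 < n) :
    ∫⁻ x : EuclideanSpace ℝ (Fin n), decayWeight x ^ 2 < ∞ := by
  have h := finite_integral_one_add_norm (E := EuclideanSpace ℝ (Fin n)) (μ := volume)
    (r := 2 * n) (by rw [finrank_euclideanSpace_fin]; have : (0 : ℝ) < n := by exact_mod_cast hn
                     linarith)
  refine lt_of_le_of_lt (lintegral_mono fun x => ?_) h
  rw [decayWeight, ← ENNReal.ofReal_pow (by positivity)]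
  refine ENNReal.ofReal_le_ofReal ?_
  rw [Real.rpow_neg (by positivity), inv_pow, ← pow_mul, mul_comm n 2]
  have : (1 + ‖x‖) ^ (2 * (n : ℝ)) = (1 + ‖x‖) ^ (2 * n) := by
    rw [← Real.rpow_natCast]; push_cast; rfl
  rw [this]
  gcongr
  have := Real.add_one_le_exp (1 : ℝ)
  linarith

theorem add_sq_le_four_mul (a b : ℝ≥0∞) : (a + b) ^ 2 ≤ 4 * (a ^ 2 + b ^ 2) := by
  rcases le_total a b with h | h
  · calc (a + b) ^ 2 ≤ (b + b) ^ 2 := by gcongr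
      _ = 4 * b ^ 2 := by ring
      _ ≤ _ := by gcongr; exact le_add_self
  · calc (a + b) ^ 2 ≤ (a + a) ^ 2 := by gcongr
      _ = 4 * a ^ 2 := by ring
      _ ≤ _ := by gcongr; exact le_self_add

/-! ### Pointwise and integral bounds for the maximal function with a variable exponent -/

variable {s : EuclideanSpace ℝ (Fin n) → ℝ} {A sinf : ℝ}

theorem exists_inv_volume_ball_le (hn : 0 < n) : ∃ κ : ℝ, 1 ≤ κ ∧
    ∀ (c : EuclideanSpace ℝ (Fin n)) {ρ : ℝ}, 0 < ρ →
      (volume (ball c ρ))⁻¹ ≤ ENNReal.ofReal (κ * (Real.exp 1 + 1 / (2 * ρ)) ^ n) := by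
  have : Nonempty (Fin n) := ⟨⟨0, hn⟩⟩
  set V := volume (ball (0 : EuclideanSpace ℝ (Fin n)) 1) with hV
  have hV0 : V ≠ 0 := (measure_ball_pos _ _ one_pos).ne'
  have hVt : V ≠ ∞ := measure_ball_lt_top.ne
  obtain ⟨v, hv, hVv⟩ : ∃ v : ℝ, 0 < v ∧ V = ENNReal.ofReal v :=
    ⟨V.toReal, ENNReal.toReal_pos hV0 hVt, (ENNReal.ofReal_toReal hVt).symm⟩
  refine ⟨max 1 (2 ^ n * v⁻¹), le_max_left _ _, fun c ρ hρ => ?_⟩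
  rw [Measure.addHaar_ball_of_pos _ c hρ, finrank_euclideanSpace_fin, ← hV, hVv,
    ← ENNReal.ofReal_mul (by positivity), ← ENNReal.ofReal_inv_of_pos (by positivity)]
  refine ENNReal.ofReal_le_ofReal ?_
  calc (ρ ^ n * v)⁻¹ = (2 ^ n * v⁻¹) * (1 / (2 * ρ)) ^ n := by
        rw [div_pow, mul_pow, one_pow]; field_simp
    _ ≤ _ := by
        gcongr
        · exact le_max_right _ _
        · linarith [Real.exp_pos 1]

/-- Where `h ≥ 1`, lowering the exponent lowers the power. So Jensen is applied with a constant `b ≤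
s` on the ball, and the exponent `s x` is then recovered from `b`. The recovery costs a constant:
the average of `h ^ s` has square at most the inverse volume of the ball, and `s x / b` exceeds `1`
by at most `A / log t`. -/
theorem rpow_laverage_large_le {κ : ℝ} (hκ : 1 ≤ κ)
    (hvol : ∀ (c : EuclideanSpace ℝ (Fin n)) {ρ : ℝ}, 0 < ρ →
      (volume (ball c ρ))⁻¹ ≤ ENNReal.ofReal (κ * (Real.exp 1 + 1 / (2 * ρ)) ^ n))
    (hs : Measurable s) (hs1 : ∀ x, 1 ≤ s x) (hA : 0 ≤ A)
    (hloc : ∀ x y, |s x - s y| ≤ A / Real.log (Real.exp 1 + 1 / ‖x - y‖))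
    {h : EuclideanSpace ℝ (Fin n) → ℝ≥0∞} (hh : Measurable h)
    (hint : ∫⁻ x, (h x ^ s x) ^ 2 ≤ 1) {x c : EuclideanSpace ℝ (Fin n)} {ρ : ℝ}
    (hx : x ∈ ball c ρ) :
    (⨍⁻ y in ball c ρ, {y | 1 ≤ h y}.indicator h y ∂volume) ^ s x ≤
      ENNReal.ofReal (κ ^ A * Real.exp (n * A)) * ⨍⁻ y in ball c ρ, h y ^ s y ∂volume := by
  have hρ : 0 < ρ := pos_of_mem_ball hx
  set t := Real.exp 1 + 1 / (2 * ρ) with ht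
  have hte : Real.exp 1 ≤ t := by rw [ht]; have : 0 < 1 / (2 * ρ) := by positivity
                                  linarith
  have h1 : 1 ≤ Real.log t := by
    rw [← Real.log_exp 1]; exact Real.log_le_log (Real.exp_pos 1) hte
  have hH : Measurable fun y => h y ^ s y := hh.pow hs
  -- A lower bound for `s` on the ball: points there are at distance less than `2 * ρ`, so local
  -- log-Hölder continuity bounds the drop below `s x` by `A / log t`.
  set b := max 1 (s x - A / Real.log t) with hb
  have hb1 : 1 ≤ b := le_max_left _ _
  have hAl : 0 ≤ A / Real.log t := by positivity
  have hbx : b ≤ s x := max_le (hs1 x) (by linarith)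
  have hby : ∀ y ∈ ball c ρ, b ≤ s y := by
    intro y hy
    refine max_le (hs1 y) ?_
    rcases eq_or_ne x y with rfl | hxy
    · linarith
    have hd : ‖x - y‖ < 2 * ρ := by
      rw [← dist_eq_norm]
      have := dist_triangle_right x y c
      rw [mem_ball] at hx hy
      linarith
    have hd0 : 0 < ‖x - y‖ := norm_pos_iff.2 (sub_ne_zero.2 hxy)
    have hl : Real.log t ≤ Real.log (Real.exp 1 + 1 / ‖x - y‖) := by
      refine Real.log_le_log ((Real.exp_pos 1).trans_le hte) ?_
      rw [ht]; gcongr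
    have := (abs_le.1 ((hloc x y).trans (div_le_div_of_nonneg_left hA (by linarith) hl))).2
    linarith
  have e : s x = b * (s x / b) := by field_simp
  have hk : Measurable ({y | 1 ≤ h y}.indicator h) :=
    hh.indicator (measurableSet_le measurable_const hh)
  have hkH : (⨍⁻ y in ball c ρ, {y | 1 ≤ h y}.indicator h y ∂volume) ^ b ≤
      ⨍⁻ y in ball c ρ, h y ^ s y ∂volume := by
    refine (rpow_laverage_ball_le c hρ hk hb1).trans ?_
    rw [setLAverage_eq, setLAverage_eq]
    gcongr ?_ / _
    refine setLIntegral_mono hH fun y hy => ?_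
    by_cases hy1 : 1 ≤ h y
    · rw [indicator_of_mem (by exact hy1)]
      exact ENNReal.rpow_le_rpow_of_exponent_le hy1 (hby y hy)
    · rw [indicator_of_notMem (by exact hy1), ENNReal.zero_rpow_of_pos (by linarith)]
      exact zero_le
  have hsq : (⨍⁻ y in ball c ρ, h y ^ s y ∂volume) ^ 2 ≤ ENNReal.ofReal (κ * t ^ n) := by
    have := rpow_laverage_ball_le c hρ hH (a := 2) one_le_two
    simp only [ENNReal.rpow_two] at this
    refine this.trans (le_trans ?_ (hvol c hρ))
    rw [setLAverage_eq, ENNReal.div_eq_inv_mul]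
    calc _ ≤ (volume (ball c ρ))⁻¹ * 1 := by
          gcongr
          exact (setLIntegral_le_lintegral _ _).trans hint
      _ = _ := mul_one _
  rw [e, ENNReal.rpow_mul]
  calc _ ≤ (⨍⁻ y in ball c ρ, h y ^ s y ∂volume) ^ (s x / b) :=
        ENNReal.rpow_le_rpow hkH (by positivity [hs1 x])
    _ ≤ _ := by
      refine rpow_le_mul_of_sq_le hκ hte hA hsq ((one_le_div (by linarith)).2 hbx) ?_
      rw [div_le_iff₀ (by linarith)]
      have : s x - A / Real.log t ≤ b := le_max_right _ _
      nlinarith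

theorem laverage_ball_le_one (c : EuclideanSpace ℝ (Fin n)) {ρ : ℝ}
    {f : EuclideanSpace ℝ (Fin n) → ℝ≥0∞} (hf : ∀ y, f y ≤ 1) :
    ⨍⁻ y in ball c ρ, f y ∂volume ≤ 1 := by
  rw [setLAverage_eq]
  refine ENNReal.div_le_of_le_mul ?_
  calc ∫⁻ y in ball c ρ, f y ≤ ∫⁻ y in ball c ρ, 1 := lintegral_mono hf
    _ = _ := by rw [setLIntegral_const]

/-- Where `h < 1`, the exponent is changed from `s x` to `sinf`, Jensen is applied with `sinf`, and
`sinf` is changed to `s y` under the average. Each change uses the decay condition at infinity and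
costs a factor and a `decayWeight`. -/
theorem rpow_laverage_small_le (hs : Measurable s) (hs1 : ∀ x, 1 ≤ s x) (hsinf : 1 ≤ sinf)
    (hinf : ∀ x, |s x - sinf| ≤ A / Real.log (Real.exp 1 + ‖x‖))
    {h : EuclideanSpace ℝ (Fin n) → ℝ≥0∞} (hh : Measurable h)
    {x c : EuclideanSpace ℝ (Fin n)} {ρ : ℝ} (hx : x ∈ ball c ρ) :
    (⨍⁻ y in ball c ρ, {y | 1 ≤ h y}ᶜ.indicator h y ∂volume) ^ s x ≤
      ENNReal.ofReal (Real.exp (n * A)) * (ENNReal.ofReal (Real.exp (n * A)) *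
        (⨍⁻ y in ball c ρ, h y ^ s y ∂volume) + ⨍⁻ y in ball c ρ, decayWeight y ∂volume) +
        decayWeight x := by
  have hρ : 0 < ρ := pos_of_mem_ball hx
  set D := ENNReal.ofReal (Real.exp (n * A)) with hD
  set k := {y | 1 ≤ h y}ᶜ.indicator h with hkdef
  have hk : Measurable k := hh.indicator (measurableSet_le measurable_const hh).compl
  have hk1 : ∀ y, k y ≤ 1 := by
    intro y
    refine indicator_le' (g := fun _ => 1) (fun y hy => ?_) (fun _ _ => zero_le_one) y
    exact (not_le.1 (show ¬ 1 ≤ h y from hy)).le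
  have hte : ∀ y : EuclideanSpace ℝ (Fin n), Real.exp 1 ≤ Real.exp 1 + ‖y‖ :=
    fun y => by linarith [norm_nonneg y]
  have hH : Measurable fun y => h y ^ s y := hh.pow hs
  calc _ ≤ D * (⨍⁻ y in ball c ρ, k y ∂volume) ^ sinf + decayWeight x :=
        rpow_le_mul_rpow_add (laverage_ball_le_one c hk1) (hte x) (hs1 x) hsinf (hinf x)
    _ ≤ D * (⨍⁻ y in ball c ρ, k y ^ sinf ∂volume) + decayWeight x := by
        gcongr
        exact rpow_laverage_ball_le c hρ hk hsinf
    _ ≤ D * (⨍⁻ y in ball c ρ, (D * h y ^ s y + decayWeight y) ∂volume) + decayWeight x := by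
        gcongr _ * ?_ + _
        refine lintegral_mono fun y => ?_
        refine (rpow_le_mul_rpow_add (n := n) (hk1 y) (hte y) hsinf (hs1 y)
          (by rw [abs_sub_comm]; exact hinf y)).trans ?_
        simp only [decayWeight]
        gcongr
        · exact (zero_le_one.trans (hs1 y))
        · exact indicator_le_self _ _ _
    _ = _ := by
        rw [setLAverage_eq, setLAverage_eq, setLAverage_eq,
          lintegral_add_right _ measurable_decayWeight, lintegral_const_mul _ hH, ENNReal.add_div,
          mul_div_assoc]

theorem exists_rpow_ballMax_le (hn : 0 < n) (hs : Measurable s) (hs1 : ∀ x, 1 ≤ s x)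
    (hsinf : 1 ≤ sinf) (hA : 0 ≤ A)
    (hloc : ∀ x y, |s x - s y| ≤ A / Real.log (Real.exp 1 + 1 / ‖x - y‖))
    (hinf : ∀ x, |s x - sinf| ≤ A / Real.log (Real.exp 1 + ‖x‖)) :
    ∃ C : ℝ≥0∞, C ≠ ∞ ∧ ∀ h : EuclideanSpace ℝ (Fin n) → ℝ≥0∞, Measurable h →
      ∫⁻ x, (h x ^ s x) ^ 2 ≤ 1 → ∀ x, ballMax h x ^ s x ≤
        C * (ballMax (fun y => h y ^ s y) x + (ballMax decayWeight x + decayWeight x)) := by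
  obtain ⟨κ, hκ, hvol⟩ := exists_inv_volume_ball_le hn
  set C₁ := ENNReal.ofReal (κ ^ A * Real.exp (n * A)) with hC₁
  set D := ENNReal.ofReal (Real.exp (n * A)) with hD
  have hsS : ∀ x, s x ≤ sinf + A := by
    intro x
    have h1 : 1 ≤ Real.log (Real.exp 1 + ‖x‖) := by
      rw [← Real.log_exp 1]
      exact Real.log_le_log (Real.exp_pos 1) (by rw [Real.log_exp]; linarith [norm_nonneg x])
    have := (abs_le.1 ((hinf x).trans (div_le_self hA h1))).2
    linarith
  -- The power of `2` comes from `(u + v) ^ s ≤ 2 ^ (s - 1) * (u ^ s + v ^ s)` and `s ≤ sinf + A`;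
  -- the other factor dominates each coefficient in the two bounds.
  refine ⟨2 ^ (sinf + A) * (C₁ + D * D + D + 1), ?_, fun h hh hint x => ?_⟩
  · have : (2 : ℝ≥0∞) ^ (sinf + A) ≠ ∞ :=
      ENNReal.rpow_ne_top_of_nonneg (by linarith) ENNReal.ofNat_ne_top
    have hC₁t : C₁ ≠ ∞ := ENNReal.ofReal_ne_top
    have hDt : D ≠ ∞ := ENNReal.ofReal_ne_top
    finiteness
  have hsx : 0 < s x := by linarith [hs1 x]
  set H := fun y => h y ^ s y with hHdef
  set Q := 2 ^ (sinf + A) * (C₁ + D * D + D + 1) *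
    (ballMax H x + (ballMax decayWeight x + decayWeight x)) with hQ
  rw [← ENNReal.le_rpow_inv_iff hsx]
  refine ballMax_le_iff.2 fun c ρ hx => ?_
  rw [ENNReal.le_rpow_inv_iff hsx]
  have hρ : 0 < ρ := pos_of_mem_ball hx
  have hms : MeasurableSet {y | 1 ≤ h y} := measurableSet_le measurable_const hh
  have hsplit : ⨍⁻ y in ball c ρ, h y ∂volume =
      (⨍⁻ y in ball c ρ, {y | 1 ≤ h y}.indicator h y ∂volume) +
      ⨍⁻ y in ball c ρ, {y | 1 ≤ h y}ᶜ.indicator h y ∂volume := by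
    rw [setLAverage_eq, setLAverage_eq, setLAverage_eq, ← ENNReal.add_div,
      ← lintegral_add_left (hh.indicator hms)]
    congr 2
    exact (indicator_self_add_compl _ _).symm
  have hl := rpow_laverage_large_le hκ hvol hs hs1 hA hloc hh hint hx
  have hm := rpow_laverage_small_le hs hs1 hsinf hinf hh hx
  have hH := laverage_le_ballMax H hx
  have hw := laverage_le_ballMax decayWeight hx
  rw [hsplit]
  refine (ENNReal.rpow_add_le_mul_rpow_add_rpow _ _ (hs1 x)).trans ?_
  rw [hQ, mul_assoc]
  refine mul_le_mul' (ENNReal.rpow_le_rpow_of_exponent_le one_le_two (by linarith [hsS x])) ?_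
  refine (add_le_add hl hm).trans ?_
  refine (add_le_add (mul_le_mul_right hH C₁) (add_le_add_left (mul_le_mul_right (add_le_add
    (mul_le_mul_right hH D) hw) D) _)).trans ?_
  set a := ballMax H x
  set b := ballMax decayWeight x
  set w := decayWeight x
  calc C₁ * a + (D * (D * a + b) + w)
      = (C₁ + D * D) * a + D * b + 1 * w := by ring
    _ ≤ (C₁ + D * D + D + 1) * a + (C₁ + D * D + D + 1) * b + (C₁ + D * D + D + 1) * w := by
        gcongr ?_ * _ + ?_ * _ + ?_ * _
        · rw [add_assoc _ D]; exact le_self_add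
        · rw [add_assoc _ D, add_comm D, ← add_assoc]; exact le_add_self
        · exact le_add_self
    _ = _ := by ring

theorem exists_lintegral_ballMax_rpow_le (hn : 0 < n) (hs : Measurable s) (hs1 : ∀ x, 1 ≤ s x)
    (hsinf : 1 ≤ sinf) (hA : 0 ≤ A)
    (hloc : ∀ x y, |s x - s y| ≤ A / Real.log (Real.exp 1 + 1 / ‖x - y‖))
    (hinf : ∀ x, |s x - sinf| ≤ A / Real.log (Real.exp 1 + ‖x‖)) :
    ∃ C : ℝ≥0∞, C ≠ ∞ ∧ ∀ h : EuclideanSpace ℝ (Fin n) → ℝ≥0∞, Measurable h →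
      ∫⁻ x, (h x ^ s x) ^ 2 ≤ 1 → ∫⁻ x, (ballMax h x ^ s x) ^ 2 ≤ C := by
  obtain ⟨C, hC, hpt⟩ := exists_rpow_ballMax_le hn hs hs1 hsinf hA hloc hinf
  set W := ∫⁻ x : EuclideanSpace ℝ (Fin n), decayWeight x ^ 2 with hW
  have hWt : W ≠ ∞ := (lintegral_decayWeight_sq_lt_top hn).ne
  refine ⟨C ^ 2 * (4 * (8 * 4 ^ n + 4 * (8 * 4 ^ n * W + W))), by finiteness,
    fun h hh hint => ?_⟩
  have hH : Measurable fun y => h y ^ s y := hh.pow hs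
  calc ∫⁻ x, (ballMax h x ^ s x) ^ 2
      ≤ ∫⁻ x, C ^ 2 * (4 * (ballMax (fun y => h y ^ s y) x ^ 2 +
          4 * (ballMax decayWeight x ^ 2 + decayWeight x ^ 2))) := by
        refine lintegral_mono fun x => ?_
        calc (ballMax h x ^ s x) ^ 2
            ≤ (C * (ballMax (fun y => h y ^ s y) x + (ballMax decayWeight x + decayWeight x))) ^ 2 :=
              pow_le_pow_left' (hpt h hh hint x) 2
          _ ≤ _ := by
              rw [mul_pow]
              gcongr
              refine (add_sq_le_four_mul _ _).trans ?_
              gcongr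
              exact add_sq_le_four_mul _ _
    _ = C ^ 2 * (4 * ((∫⁻ x, ballMax (fun y => h y ^ s y) x ^ 2) +
          4 * ((∫⁻ x : EuclideanSpace ℝ (Fin n), ballMax decayWeight x ^ 2) + W))) := by
        rw [lintegral_const_mul' _ _ (by finiteness), lintegral_const_mul' _ _ (by finiteness),
          lintegral_add_left ((measurable_ballMax _).pow_const 2),
          lintegral_const_mul' _ _ (by finiteness),
          lintegral_add_left ((measurable_ballMax _).pow_const 2)]
    _ ≤ _ := by
        gcongr
        · calc _ ≤ _ := lintegral_ballMax_sq_le hn hH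
            _ ≤ 8 * 4 ^ n * 1 := by gcongr
            _ = _ := mul_one _
        · exact lintegral_ballMax_sq_le hn measurable_decayWeight

end VariableExponent

/-! ### Heat kernel estimates -/

section HeatKernel

variable {n : ℕ}

/-- Gaussian size and regularity estimates for `K`, at the times `τ ^ 2`. -/
structure HeatKernelEstimates
    (K : ℝ → EuclideanSpace ℝ (Fin n) → EuclideanSpace ℝ (Fin n) → ℂ) (C b ν : ℝ) : Prop where
  measurable : ∀ τ : ℝ, 0 < τ → Measurable (Function.uncurry (K (τ ^ 2)))
  size : ∀ τ : ℝ, 0 < τ → ∀ y z,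
    ‖K (τ ^ 2) y z‖ ≤ C * ((τ ^ n)⁻¹ * Real.exp (-(b * (‖y - z‖ / τ) ^ 2)))
  regularity : ∀ τ : ℝ, 0 < τ → ∀ y₁ y₂ z, ‖y₁ - y₂‖ ≤ τ →
    ‖K (τ ^ 2) y₁ z - K (τ ^ 2) y₂ z‖ ≤
      C * (‖y₁ - y₂‖ / τ) ^ ν * ((τ ^ n)⁻¹ * Real.exp (-(b * (‖y₁ - z‖ / τ) ^ 2)))

theorem sq_rpow_half {τ : ℝ} (hτ : 0 < τ) (a : ℝ) : (τ ^ 2) ^ (a / 2) = τ ^ a := by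
  rw [← Real.rpow_natCast, ← Real.rpow_mul hτ.le]; congr 1; push_cast; ring

/-- The Hölder hypothesis has no decay, so it is combined with the size bound by a geometric mean;
hence `ν = μ / 2`. Passing from `y₂` to `y₁` in the Gaussian halves its rate, and the square root
halves it again, which gives `(4 * c)⁻¹`. -/
theorem exists_heatKernelEstimates {L : L2Space n →ₗ.[ℂ] L2Space n}
    {K : ℝ → EuclideanSpace ℝ (Fin n) → EuclideanSpace ℝ (Fin n) → ℂ}
    (hK : IsHeatKernel L K) (hGauss : HasGaussianBound K) (hHolder : HasHolderBound K) :
    ∃ C b ν : ℝ, 0 < C ∧ 0 < b ∧ 0 < ν ∧ HeatKernelEstimates K C b ν := by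
  obtain ⟨C₁, c, hC₁, hc, hG⟩ := hGauss
  obtain ⟨C₂, μ, hC₂, hμ, -, hH⟩ := hHolder
  have hG' : ∀ τ : ℝ, 0 < τ → ∀ y z,
      ‖K (τ ^ 2) y z‖ ≤ C₁ * ((τ ^ n)⁻¹ * Real.exp (-(c⁻¹ * (‖y - z‖ / τ) ^ 2))) := by
    intro τ hτ y z
    refine (hG (τ ^ 2) (by positivity) y z).trans_eq ?_
    rw [sq_rpow_half hτ, Real.rpow_natCast, div_eq_mul_inv, mul_assoc]
    congr 4
    field_simp
  set C₃ := C₁ * (1 + Real.exp c⁻¹) with hC₃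
  have hC₃0 : 0 < C₃ := by positivity
  have hC₁₃ : C₁ ≤ C₃ := by
    rw [hC₃]; nlinarith [mul_pos hC₁ (Real.exp_pos c⁻¹)]
  refine ⟨C₂ + C₃, (4 * c)⁻¹, μ / 2, by positivity, by positivity, by positivity,
    fun τ hτ => hK.measurable _ (by positivity), fun τ hτ y z => ?_, fun τ hτ y₁ y₂ z hd => ?_⟩
  · refine (hG' τ hτ y z).trans ?_
    gcongr
    · linarith
    · linarith
  have hr : ‖y₁ - z‖ / τ ≤ ‖y₂ - z‖ / τ + 1 := by
    rw [div_add_one hτ.ne']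
    gcongr
    calc ‖y₁ - z‖ = ‖(y₂ - z) + (y₁ - y₂)‖ := by congr 1; abel
      _ ≤ ‖y₂ - z‖ + τ := (norm_add_le _ _).trans (by linarith)
  set r₁ := ‖y₁ - z‖ / τ with hr₁
  set r₂ := ‖y₂ - z‖ / τ with hr₂
  have hr₁0 : 0 ≤ r₁ := by positivity
  have hr₂0 : 0 ≤ r₂ := by positivity
  set T := (τ ^ n)⁻¹ with hT
  have hT0 : 0 < T := by positivity
  set X := ‖y₁ - y₂‖ / τ with hX
  have hX0 : 0 ≤ X := by positivity
  have h1 : ‖K (τ ^ 2) y₁ z - K (τ ^ 2) y₂ z‖ ≤ C₂ * (T * X ^ μ) := by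
    refine (hH (τ ^ 2) (by positivity) z y₁ y₂).trans_eq ?_
    rw [sq_rpow_half hτ, sq_rpow_half hτ, Real.rpow_natCast, hX,
      Real.div_rpow (norm_nonneg _) hτ.le, div_eq_mul_inv C₂, mul_assoc]
  have h2 : ‖K (τ ^ 2) y₁ z - K (τ ^ 2) y₂ z‖ ≤ C₃ * (T * Real.exp (-((2 * c)⁻¹ * r₁ ^ 2))) := by
    have hc' : 0 < c⁻¹ := by positivity
    have e1 : (2 * c)⁻¹ = c⁻¹ / 2 := by rw [mul_inv]; ring
    have ha : Real.exp (-(c⁻¹ * r₁ ^ 2)) ≤ Real.exp (-((2 * c)⁻¹ * r₁ ^ 2)) := by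
      refine Real.exp_le_exp.2 ?_
      rw [e1]; nlinarith [mul_nonneg hc'.le (sq_nonneg r₁)]
    have hb : Real.exp (-(c⁻¹ * r₂ ^ 2)) ≤
        Real.exp c⁻¹ * Real.exp (-((2 * c)⁻¹ * r₁ ^ 2)) := by
      rw [← Real.exp_add]
      refine Real.exp_le_exp.2 ?_
      have : r₁ ^ 2 ≤ 2 * r₂ ^ 2 + 2 := by nlinarith [sq_nonneg (r₂ - 1)]
      rw [e1]; nlinarith
    calc _ ≤ ‖K (τ ^ 2) y₁ z‖ + ‖K (τ ^ 2) y₂ z‖ := norm_sub_le _ _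
      _ ≤ C₁ * (T * Real.exp (-((2 * c)⁻¹ * r₁ ^ 2))) +
          C₁ * (T * (Real.exp c⁻¹ * Real.exp (-((2 * c)⁻¹ * r₁ ^ 2)))) := by
        refine add_le_add ((hG' τ hτ y₁ z).trans ?_) ((hG' τ hτ y₂ z).trans ?_)
        · gcongr
        · gcongr
      _ = _ := by rw [hC₃]; ring
  refine (sq_le_sq₀ (norm_nonneg _) (by positivity)).1 ?_
  have e2 : (X ^ (μ / 2)) ^ 2 = X ^ μ := by
    rw [← Real.rpow_natCast, ← Real.rpow_mul hX0]; congr 1; push_cast; ring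
  have e3 : Real.exp (-((4 * c)⁻¹ * r₁ ^ 2)) ^ 2 = Real.exp (-((2 * c)⁻¹ * r₁ ^ 2)) := by
    rw [← Real.exp_nat_mul]; congr 1; push_cast; field_simp; norm_num
  have hXμ : 0 ≤ X ^ μ := by positivity
  calc _ ≤ (C₂ * (T * X ^ μ)) * (C₃ * (T * Real.exp (-((2 * c)⁻¹ * r₁ ^ 2)))) := by
        rw [sq]; gcongr
    _ = (C₂ * C₃) * (X ^ μ * (T ^ 2 * Real.exp (-((2 * c)⁻¹ * r₁ ^ 2)))) := by ring
    _ ≤ (C₂ + C₃) ^ 2 * (X ^ μ * (T ^ 2 * Real.exp (-((2 * c)⁻¹ * r₁ ^ 2)))) := by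
        gcongr
        nlinarith
    _ = _ := by rw [← e2, ← e3]; ring

/-- The Gaussian `τ⁻ⁿ exp (-b |y - z|² / τ²)`. -/
noncomputable def gaussWeight (b τ : ℝ) (y z : EuclideanSpace ℝ (Fin n)) : ℝ≥0∞ :=
  ENNReal.ofReal ((τ ^ n)⁻¹ * Real.exp (-(b * (‖y - z‖ / τ) ^ 2)))

theorem measurable_gaussWeight (b τ : ℝ) (y : EuclideanSpace ℝ (Fin n)) :
    Measurable (gaussWeight b τ y) := by
  unfold gaussWeight; fun_prop

theorem lintegral_gaussWeight {b τ : ℝ} (hb : 0 < b) (hτ : 0 < τ)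
    (y : EuclideanSpace ℝ (Fin n)) :
    ∫⁻ z, gaussWeight b τ y z = ENNReal.ofReal ((Real.pi / b) ^ ((n : ℝ) / 2)) := by
  have hbt : 0 < b / τ ^ 2 := by positivity
  have h := GaussianFourier.integral_rexp_neg_mul_sq_norm (V := EuclideanSpace ℝ (Fin n)) hbt
  have hint : Integrable fun z : EuclideanSpace ℝ (Fin n) => Real.exp (-(b / τ ^ 2) * ‖z‖ ^ 2) := by
    refine Integrable.of_integral_ne_zero ?_
    rw [h]; positivity
  have e : ∀ z : EuclideanSpace ℝ (Fin n), gaussWeight b τ y z =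
      ENNReal.ofReal ((τ ^ n)⁻¹) * ENNReal.ofReal (Real.exp (-(b / τ ^ 2) * ‖y - z‖ ^ 2)) := by
    intro z
    rw [gaussWeight, ← ENNReal.ofReal_mul (by positivity)]
    congr 3
    field_simp
  simp_rw [e]
  rw [lintegral_const_mul _ (by fun_prop),
    lintegral_sub_left_eq_self (fun w => ENNReal.ofReal (Real.exp (-(b / τ ^ 2) * ‖w‖ ^ 2))) y,
    ← ofReal_integral_eq_lintegral_ofReal hint (ae_of_all _ fun z => (Real.exp_pos _).le), h,
    ← ENNReal.ofReal_mul (by positivity), finrank_euclideanSpace_fin]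
  congr 1
  rw [show Real.pi / (b / τ ^ 2) = Real.pi / b * τ ^ 2 by field_simp,
    Real.mul_rpow (by positivity) (by positivity), sq_rpow_half hτ, Real.rpow_natCast]
  field_simp

/-- Follows from `x ^ N ≤ N! * exp x` at `x = 1 + r` and `r ≤ b⁻¹ + b * r ^ 2`. It lets half of a
Gaussian absorb polynomial growth. -/
theorem exists_one_add_pow_le_exp {b : ℝ} (hb : 0 < b) (N : ℕ) :
    ∃ C : ℝ, 0 < C ∧ ∀ r : ℝ, 0 ≤ r → (1 + r) ^ N ≤ C * Real.exp (b * r ^ 2) := by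
  refine ⟨N.factorial * Real.exp (1 + b⁻¹), by positivity, fun r hr => ?_⟩
  have h := Real.pow_div_factorial_le_exp (x := 1 + r) (by positivity) N
  rw [div_le_iff₀ (by positivity)] at h
  refine h.trans ?_
  rw [mul_comm, mul_assoc, ← Real.exp_add]
  refine mul_le_mul_of_nonneg_left (Real.exp_le_exp.2 ?_) (by positivity)
  have h1 : r ≤ b⁻¹ + b * r ^ 2 := by
    rcases le_total r b⁻¹ with h2 | h2
    · nlinarith [mul_nonneg hb.le (sq_nonneg r)]
    · have : 1 ≤ b * r := by rw [← mul_inv_cancel₀ hb.ne']; gcongr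
      have : 0 < b⁻¹ := by positivity
      nlinarith
  linarith

theorem exists_lintegral_gaussWeight_mul_le {b : ℝ} (hb : 0 < b) (N : ℕ) :
    ∃ C : ℝ≥0∞, C ≠ ∞ ∧ ∀ τ : ℝ, 0 < τ → ∀ y : EuclideanSpace ℝ (Fin n),
      ∫⁻ z, gaussWeight b τ y z * ENNReal.ofReal ((1 + ‖y - z‖ / τ) ^ N) ≤ C := by
  obtain ⟨C, hC, h⟩ := exists_one_add_pow_le_exp (half_pos hb) N
  refine ⟨ENNReal.ofReal C * ENNReal.ofReal ((Real.pi / (b / 2)) ^ ((n : ℝ) / 2)),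
    by finiteness, fun τ hτ y => ?_⟩
  rw [← lintegral_gaussWeight (half_pos hb) hτ y,
    ← lintegral_const_mul _ (measurable_gaussWeight _ _ _)]
  refine lintegral_mono fun z => ?_
  simp only [gaussWeight]
  rw [← ENNReal.ofReal_mul (by positivity), ← ENNReal.ofReal_mul (by positivity)]
  refine ENNReal.ofReal_le_ofReal ?_
  set r := ‖y - z‖ / τ with hr
  calc _ ≤ (τ ^ n)⁻¹ * Real.exp (-(b * r ^ 2)) * (C * Real.exp (b / 2 * r ^ 2)) := by
        gcongr; exact h r (by positivity)
    _ = C * ((τ ^ n)⁻¹ * (Real.exp (-(b * r ^ 2)) * Real.exp (b / 2 * r ^ 2))) := by ring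
    _ = _ := by rw [← Real.exp_add]; ring_nf

theorem ennreal_mul_le_sq_add_sq (a b : ℝ≥0∞) : a * b ≤ a ^ 2 + b ^ 2 := by
  rcases le_total a b with h | h
  · calc a * b ≤ b * b := by gcongr
      _ = b ^ 2 := (sq b).symm
      _ ≤ _ := le_add_self
  · calc a * b ≤ a * a := by gcongr
      _ = a ^ 2 := (sq a).symm
      _ ≤ _ := le_self_add

theorem lintegral_enorm_sq_ne_top (f : L2Space n) : ∫⁻ z, ‖f z‖ₑ ^ 2 ≠ ∞ := by
  have h := lintegral_rpow_enorm_lt_top_of_eLpNorm_lt_top two_ne_zero ENNReal.ofNat_ne_top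
    (Lp.memLp f).2
  simpa using h.ne

/-- A crude bound, not homogeneous in `f`, from `a * b ≤ a ^ 2 + b ^ 2`. It serves only to show that
quantities are finite, so the exact dependence on `f` is immaterial. -/
theorem exists_lintegral_gaussWeight_mul_enorm_le {b : ℝ} (hb : 0 < b) :
    ∃ C : ℝ≥0∞, C ≠ ∞ ∧ ∀ τ : ℝ, 0 < τ → ∀ (f : L2Space n) (y : EuclideanSpace ℝ (Fin n)),
      ∫⁻ z, gaussWeight b τ y z * ‖f z‖ₑ ≤
        C + ENNReal.ofReal ((τ ^ n)⁻¹) * ∫⁻ z, ‖f z‖ₑ ^ 2 := by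
  refine ⟨ENNReal.ofReal ((Real.pi / b) ^ ((n : ℝ) / 2)), ENNReal.ofReal_ne_top,
    fun τ hτ f y => ?_⟩
  rw [← lintegral_gaussWeight hb hτ y, ← lintegral_const_mul' _ _ ENNReal.ofReal_ne_top,
    ← lintegral_add_left (measurable_gaussWeight _ _ _)]
  refine lintegral_mono fun z => ?_
  simp only [gaussWeight]
  rw [ENNReal.ofReal_mul (by positivity), mul_assoc, ← mul_add]
  gcongr
  refine (ennreal_mul_le_sq_add_sq _ _).trans ?_
  gcongr
  refine pow_le_of_le_one zero_le ?_ two_ne_zero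
  refine ENNReal.ofReal_le_one.2 (Real.exp_le_one_iff.2 ?_)
  have : 0 ≤ b * (‖y - z‖ / τ) ^ 2 := by positivity
  linarith

namespace HeatKernelEstimates

variable {K : ℝ → EuclideanSpace ℝ (Fin n) → EuclideanSpace ℝ (Fin n) → ℂ} {C b ν : ℝ}

theorem enorm_size (h : HeatKernelEstimates K C b ν) (hC : 0 < C) {τ : ℝ} (hτ : 0 < τ)
    (y z : EuclideanSpace ℝ (Fin n)) :
    ‖K (τ ^ 2) y z‖ₑ ≤ ENNReal.ofReal C * gaussWeight b τ y z := by
  rw [gaussWeight, ← ENNReal.ofReal_mul hC.le, ← ofReal_norm]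
  exact ENNReal.ofReal_le_ofReal (h.size τ hτ y z)

theorem lintegral_gaussWeight_mul_enorm_ne_top (hb : 0 < b) {τ : ℝ} (hτ : 0 < τ) (f : L2Space n)
    (y : EuclideanSpace ℝ (Fin n)) : ∫⁻ z, gaussWeight b τ y z * ‖f z‖ₑ ≠ ∞ := by
  obtain ⟨C, hC, h⟩ := exists_lintegral_gaussWeight_mul_enorm_le (n := n) hb
  have := lintegral_enorm_sq_ne_top f
  exact ne_top_of_le_ne_top (by finiteness) (h τ hτ f y)

theorem lintegral_enorm_mul_le (h : HeatKernelEstimates K C b ν) (hC : 0 < C) {τ : ℝ}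
    (hτ : 0 < τ) (f : L2Space n) (y : EuclideanSpace ℝ (Fin n)) :
    ∫⁻ z, ‖K (τ ^ 2) y z * f z‖ₑ ≤
      ENNReal.ofReal C * ∫⁻ z, gaussWeight b τ y z * ‖f z‖ₑ := by
  rw [← lintegral_const_mul' _ _ ENNReal.ofReal_ne_top]
  refine lintegral_mono fun z => ?_
  rw [enorm_mul, ← mul_assoc]
  gcongr
  exact h.enorm_size hC hτ y z

theorem integrable (h : HeatKernelEstimates K C b ν) (hC : 0 < C) (hb : 0 < b) {τ : ℝ}
    (hτ : 0 < τ) (f : L2Space n) (y : EuclideanSpace ℝ (Fin n)) :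
    Integrable fun z => K (τ ^ 2) y z * f z := by
  refine ⟨?_, ?_⟩
  · have : Measurable fun z => K (τ ^ 2) y z :=
      (h.measurable τ hτ).comp (measurable_const.prodMk measurable_id)
    exact this.aestronglyMeasurable.mul (Lp.aestronglyMeasurable f)
  · refine lt_of_le_of_lt (h.lintegral_enorm_mul_le hC hτ f y) ?_
    exact ENNReal.mul_lt_top ENNReal.ofReal_lt_top
      (lintegral_gaussWeight_mul_enorm_ne_top hb hτ f y).lt_top

theorem enorm_heatValue_le (h : HeatKernelEstimates K C b ν) (hC : 0 < C) {τ : ℝ}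
    (hτ : 0 < τ) (f : L2Space n) (y : EuclideanSpace ℝ (Fin n)) :
    ‖heatValue K f (τ ^ 2) y‖ₑ ≤ ENNReal.ofReal C * ∫⁻ z, gaussWeight b τ y z * ‖f z‖ₑ :=
  (enorm_integral_le_lintegral_enorm _).trans (h.lintegral_enorm_mul_le hC hτ f y)

theorem enorm_heatValue_sub_le (h : HeatKernelEstimates K C b ν) (hC : 0 < C) (hb : 0 < b) {τ : ℝ}
    (hτ : 0 < τ) (f : L2Space n) {y₁ y₂ : EuclideanSpace ℝ (Fin n)} (hd : ‖y₁ - y₂‖ ≤ τ) :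
    ‖heatValue K f (τ ^ 2) y₁ - heatValue K f (τ ^ 2) y₂‖ₑ ≤
      ENNReal.ofReal (C * (‖y₁ - y₂‖ / τ) ^ ν) * ∫⁻ z, gaussWeight b τ y₁ z * ‖f z‖ₑ := by
  rw [heatValue, heatValue, ← integral_sub (h.integrable hC hb hτ f y₁) (h.integrable hC hb hτ f y₂),
    ← lintegral_const_mul' _ _ ENNReal.ofReal_ne_top]
  refine (enorm_integral_le_lintegral_enorm _).trans (lintegral_mono fun z => ?_)
  rw [← sub_mul, enorm_mul, ← mul_assoc]
  gcongr
  rw [gaussWeight, ← ENNReal.ofReal_mul (by positivity), ← ofReal_norm]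
  exact ENNReal.ofReal_le_ofReal (h.regularity τ hτ y₁ y₂ z hd)

theorem continuous_heatValue (h : HeatKernelEstimates K C b ν) (hC : 0 < C) (hb : 0 < b)
    (hν : 0 < ν) {τ : ℝ} (hτ : 0 < τ) (f : L2Space n) : Continuous (heatValue K f (τ ^ 2)) := by
  rw [continuous_iff_continuousAt]
  intro y
  rw [ContinuousAt, tendsto_iff_edist_tendsto_0]
  have hI := lintegral_gaussWeight_mul_enorm_ne_top hb hτ f y
  have hlim : Filter.Tendsto (fun x => ENNReal.ofReal (C * (‖y - x‖ / τ) ^ ν) *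
      ∫⁻ z, gaussWeight b τ y z * ‖f z‖ₑ) (nhds y) (nhds 0) := by
    have h1 : Continuous fun x => ENNReal.ofReal (C * (‖y - x‖ / τ) ^ ν) := by
      refine ENNReal.continuous_ofReal.comp (continuous_const.mul ?_)
      exact Continuous.rpow_const (by fun_prop) fun _ => Or.inr hν.le
    have h2 := ENNReal.Tendsto.mul_const (h1.tendsto y) (Or.inr hI)
    simpa [hν.ne'] using h2
  refine tendsto_of_tendsto_of_tendsto_of_le_of_le' tendsto_const_nhds hlim
    (Filter.Eventually.of_forall fun _ => zero_le) ?_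
  filter_upwards [Metric.closedBall_mem_nhds y hτ] with x hx
  rw [edist_comm, edist_eq_enorm_sub]
  refine h.enorm_heatValue_sub_le hC hb hτ f ?_
  rwa [← dist_eq_norm, dist_comm]

end HeatKernelEstimates

/-! ### The semigroup law and its consequence for oscillation -/

theorem heatSemigroup_add {H : Type*} [NormedAddCommGroup H] [InnerProductSpace ℂ H]
    [CompleteSpace H] {L : H →ₗ.[ℂ] H} {a b : ℝ} (ha : 0 < a) (hb : 0 < b) :
    heatSemigroup L (a + b) = heatSemigroup L a * heatSemigroup L b := by
  rw [heatSemigroup, heatSemigroup, heatSemigroup, ← cfc_mul _ _ _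
    (continuous_heatSymbol ha).continuousOn (continuous_heatSymbol hb).continuousOn]
  congr 1
  funext s
  simp only [heatSymbol]
  split_ifs
  · simp
  · rw [← Real.exp_add]; congr 1; ring

/-- The kernel represents the operator only almost everywhere; continuity of both sides upgrades the
semigroup law to every point. -/
theorem heatValue_heatSemigroup {L : L2Space n →ₗ.[ℂ] L2Space n}
    {K : ℝ → EuclideanSpace ℝ (Fin n) → EuclideanSpace ℝ (Fin n) → ℂ} (hK : IsHeatKernel L K)
    {C b ν : ℝ} (h : HeatKernelEstimates K C b ν) (hC : 0 < C) (hb : 0 < b) (hν : 0 < ν)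
    {τ t : ℝ} (hτ : 0 < τ) (ht : 0 < t) (htτ : t ^ 2 = τ ^ 2 + τ ^ 2) (f : L2Space n) :
    heatValue K f (t ^ 2) = heatValue K (heatSemigroup L (τ ^ 2) f) (τ ^ 2) := by
  refine (Continuous.ae_eq_iff_eq volume (h.continuous_heatValue hC hb hν ht f)
    (h.continuous_heatValue hC hb hν hτ _)).1 ?_
  have hτ2 : 0 < τ ^ 2 := by positivity
  have h1 := hK.ae_eq (t ^ 2) (by positivity) f
  have h2 := hK.ae_eq (τ ^ 2) hτ2 (heatSemigroup L (τ ^ 2) f)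
  rw [htτ, heatSemigroup_add hτ2 hτ2, ← htτ] at h1
  filter_upwards [h1, h2] with x hx1 hx2
  rw [heatValue, heatValue, ← hx1, ← hx2]
  rfl

/-- The oscillation at time `t` is controlled by the solution at the earlier time `τ` rather than by
`f`. This is what allows a self-improving estimate. -/
theorem enorm_heatValue_sub_le_lintegral {L : L2Space n →ₗ.[ℂ] L2Space n}
    {K : ℝ → EuclideanSpace ℝ (Fin n) → EuclideanSpace ℝ (Fin n) → ℂ} (hK : IsHeatKernel L K)
    {C b ν : ℝ} (h : HeatKernelEstimates K C b ν) (hC : 0 < C) (hb : 0 < b) (hν : 0 < ν)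
    {τ t : ℝ} (hτ : 0 < τ) (ht : 0 < t) (htτ : t ^ 2 = τ ^ 2 + τ ^ 2) (f : L2Space n)
    {y₁ y₂ : EuclideanSpace ℝ (Fin n)} (hd : ‖y₁ - y₂‖ ≤ τ) :
    ‖heatValue K f (t ^ 2) y₁ - heatValue K f (t ^ 2) y₂‖ₑ ≤
      ENNReal.ofReal (C * (‖y₁ - y₂‖ / τ) ^ ν) *
        ∫⁻ z, gaussWeight b τ y₁ z * ‖heatValue K f (τ ^ 2) z‖ₑ := by
  rw [heatValue_heatSemigroup hK h hC hb hν hτ ht htτ]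
  refine (h.enorm_heatValue_sub_le hC hb hτ _ hd).trans_eq ?_
  congr 1
  refine lintegral_congr_ae ?_
  filter_upwards [hK.ae_eq (τ ^ 2) (by positivity) f] with z hz
  rw [hz, heatValue]

/-- The supremum is uncountable, but it is one of continuous functions, hence lower semicontinuous.
-/
theorem measurable_radialMax {K : ℝ → EuclideanSpace ℝ (Fin n) → EuclideanSpace ℝ (Fin n) → ℂ}
    {C b ν : ℝ} (h : HeatKernelEstimates K C b ν) (hC : 0 < C) (hb : 0 < b) (hν : 0 < ν)
    (f : L2Space n) : Measurable (radialMax K f) := by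
  have : LowerSemicontinuous (radialMax K f) := by
    refine lowerSemicontinuous_iSup fun t => lowerSemicontinuous_iSup fun ht => ?_
    exact (continuous_enorm.comp (h.continuous_heatValue hC hb hν ht f)).lowerSemicontinuous
  exact this.measurable

end HeatKernel

/-! ### Pointwise domination of the non-tangential maximal function -/

section Pointwise

open Metric

variable {n : ℕ}

/-- The weight in the auxiliary tangential maximal function; the second factor makes that function
finite. -/
noncomputable def tangentialWeight (N : ℕ) (ε : ℝ) (x : EuclideanSpace ℝ (Fin n)) (t : ℝ)
    (y : EuclideanSpace ℝ (Fin n)) : ℝ :=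
  (1 + ‖x - y‖ / t) ^ N * (1 + ε / t) ^ N

theorem one_le_tangentialWeight {N : ℕ} {ε t : ℝ} (hε : 0 < ε) (ht : 0 < t)
    (x y : EuclideanSpace ℝ (Fin n)) : 1 ≤ tangentialWeight N ε x t y := by
  have h1 : 0 ≤ ‖x - y‖ / t := by positivity
  have h2 : 0 ≤ ε / t := by positivity
  exact one_le_mul_of_one_le_of_one_le (one_le_pow₀ (by linarith)) (one_le_pow₀ (by linarith))

/-- Replacing `t` by `τ ≥ t / 2` costs `2 ^ N` in each of the two factors. Moving from `y` to `z`
costs a polynomial that the Gaussian absorbs. -/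
theorem tangentialWeight_le {N : ℕ} {ε t τ : ℝ} (hε : 0 < ε) (ht : 0 < t) (hτ : 0 < τ)
    (htτ : t ≤ 2 * τ) (x y z : EuclideanSpace ℝ (Fin n)) :
    tangentialWeight N ε x τ z ≤
      4 ^ N * tangentialWeight N ε x t y * (1 + ‖y - z‖ / τ) ^ N := by
  have hinv : ∀ a : ℝ, 0 ≤ a → 1 + a / τ ≤ 2 * (1 + a / t) := by
    intro a ha
    have : a / τ ≤ 2 * (a / t) := by
      rw [← mul_div_assoc, div_le_div_iff₀ hτ ht]
      nlinarith
    linarith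
  have h1 : 1 + ‖x - z‖ / τ ≤ (1 + ‖x - y‖ / τ) * (1 + ‖y - z‖ / τ) := by
    have h3 : ‖x - z‖ / τ ≤ ‖x - y‖ / τ + ‖y - z‖ / τ := by
      rw [← add_div]; gcongr; exact norm_sub_le_norm_sub_add_norm_sub _ _ _
    have h4 : 0 ≤ ‖x - y‖ / τ * (‖y - z‖ / τ) := by positivity
    linarith
  have h2 : 1 + ‖x - z‖ / τ ≤ 2 * (1 + ‖x - y‖ / t) * (1 + ‖y - z‖ / τ) :=
    h1.trans (by gcongr; exact hinv _ (norm_nonneg _))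
  calc tangentialWeight N ε x τ z
      ≤ (2 * (1 + ‖x - y‖ / t) * (1 + ‖y - z‖ / τ)) ^ N * (2 * (1 + ε / t)) ^ N := by
        unfold tangentialWeight
        gcongr
        exact hinv _ hε.le
    _ = _ := by
        rw [tangentialWeight, show (4 : ℝ) = 2 * 2 by norm_num]
        simp only [mul_pow]
        ring

theorem lintegral_gaussWeight_mul_le_of_le {b : ℝ} {N : ℕ} {G : ℝ≥0∞} {ε t τ : ℝ} (hε : 0 < ε)
    (ht : 0 < t) (hτ : 0 < τ) (htτ : t ≤ 2 * τ) {x : EuclideanSpace ℝ (Fin n)}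
    (hG : ∀ y : EuclideanSpace ℝ (Fin n),
      ∫⁻ z, gaussWeight b τ y z * ENNReal.ofReal ((1 + ‖y - z‖ / τ) ^ N) ≤ G)
    {v : EuclideanSpace ℝ (Fin n) → ℝ≥0∞} {F : ℝ≥0∞}
    (hv : ∀ z, v z ≤ F * ENNReal.ofReal (tangentialWeight N ε x τ z))
    (y : EuclideanSpace ℝ (Fin n)) :
    ∫⁻ z, gaussWeight b τ y z * v z ≤
      F * ENNReal.ofReal (4 ^ N * tangentialWeight N ε x t y) * G := by
  have hW := one_le_tangentialWeight (N := N) hε ht x y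
  calc ∫⁻ z, gaussWeight b τ y z * v z
      ≤ ∫⁻ z, F * ENNReal.ofReal (4 ^ N * tangentialWeight N ε x t y) *
          (gaussWeight b τ y z * ENNReal.ofReal ((1 + ‖y - z‖ / τ) ^ N)) := by
        refine lintegral_mono fun z => ?_
        calc gaussWeight b τ y z * v z
            ≤ gaussWeight b τ y z * (F * ENNReal.ofReal
                (4 ^ N * tangentialWeight N ε x t y * (1 + ‖y - z‖ / τ) ^ N)) := by
              gcongr
              refine (hv z).trans ?_
              gcongr
              exact tangentialWeight_le hε ht hτ htτ x y z
          _ = _ := by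
              rw [ENNReal.ofReal_mul (p := 4 ^ N * _) (by positivity)]; ring
    _ = F * ENNReal.ofReal (4 ^ N * tangentialWeight N ε x t y) *
          ∫⁻ z, gaussWeight b τ y z * ENNReal.ofReal ((1 + ‖y - z‖ / τ) ^ N) :=
        lintegral_const_mul _ ((measurable_gaussWeight _ _ _).mul (by fun_prop))
    _ ≤ _ := by gcongr; exact hG y

/-- The small ball about `y` lies in a ball about `x` of radius `|x - y| + t`. The volume ratio is
`δ⁻ⁿ (1 + |x - y|/t)ⁿ`, and `n ≤ N * r` places its `r`-th root under the tangential weight. -/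
theorem le_mul_ballMax_of_le_on_ball {N : ℕ} {r δ t ε : ℝ} (hr : 0 < r) (hNr : n ≤ N * r)
    (hδ : 0 < δ) (hδ1 : δ ≤ 1) (ht : 0 < t) (hε : 0 < ε)
    {R : EuclideanSpace ℝ (Fin n) → ℝ≥0∞} {a : ℝ≥0∞} {x y : EuclideanSpace ℝ (Fin n)}
    (h : ∀ z ∈ ball y (δ * t), a ≤ R z) :
    a ≤ ENNReal.ofReal (tangentialWeight N ε x t y) *
      (ENNReal.ofReal ((δ ^ n)⁻¹) ^ (1 / r) * ballMax (fun z => R z ^ r) x ^ (1 / r)) := by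
  set M := ballMax (fun z => R z ^ r) x with hM
  set W := tangentialWeight N ε x t y with hW
  have hW1 : 1 ≤ W := one_le_tangentialWeight hε ht x y
  have hδt : 0 < δ * t := by positivity
  set ρ := ‖x - y‖ + t with hρdef
  have hρ : 0 < ρ := by positivity
  set V := volume (ball (0 : EuclideanSpace ℝ (Fin n)) 1) with hV
  have hV0 : V ≠ 0 := (measure_ball_pos _ _ one_pos).ne'
  have hVt : V ≠ ∞ := measure_ball_lt_top.ne
  have hvol : ∀ (c : EuclideanSpace ℝ (Fin n)) {ρ : ℝ}, 0 < ρ →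
      volume (ball c ρ) = ENNReal.ofReal (ρ ^ n) * V := by
    intro c ρ hρ
    rw [Measure.addHaar_ball_of_pos _ c hρ, finrank_euclideanSpace_fin]
  have hsub : ball y (δ * t) ⊆ ball x ρ := by
    refine ball_subset_ball' ?_
    rw [dist_eq_norm, norm_sub_rev, hρdef]
    nlinarith
  have h1 : a ^ r * volume (ball y (δ * t)) ≤ volume (ball x ρ) * M := by
    calc a ^ r * volume (ball y (δ * t)) = ∫⁻ z in ball y (δ * t), a ^ r := by
          rw [setLIntegral_const]
      _ ≤ ∫⁻ z in ball y (δ * t), R z ^ r :=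
          setLIntegral_mono' measurableSet_ball fun z hz => ENNReal.rpow_le_rpow (h z hz) hr.le
      _ ≤ ∫⁻ z in ball x ρ, R z ^ r := lintegral_mono_set hsub
      _ ≤ volume (ball x ρ) * M := by
          have h2 := laverage_le_ballMax (fun z => R z ^ r) (mem_ball_self hρ (x := x))
          rw [setLAverage_eq, ENNReal.div_le_iff (measure_ball_pos _ _ hρ).ne'
            measure_ball_lt_top.ne] at h2
          rwa [mul_comm]
  have h2 : a ^ r ≤ ENNReal.ofReal ((δ ^ n)⁻¹) * ENNReal.ofReal W ^ r * M := by
    have hc : (δ * t) ^ n ≠ 0 := by positivity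
    have hV' : volume (ball x ρ) =
        ENNReal.ofReal ((δ ^ n)⁻¹ * (1 + ‖x - y‖ / t) ^ n) * volume (ball y (δ * t)) := by
      rw [hvol _ hρ, hvol _ hδt, ← mul_assoc, ← ENNReal.ofReal_mul (by positivity)]
      congr 2
      have : ρ = (1 + ‖x - y‖ / t) * t := by rw [hρdef]; field_simp; ring
      rw [this, mul_pow, mul_pow]
      field_simp
    rw [hV', mul_assoc, mul_comm (volume _) M, ← mul_assoc] at h1
    have h3 := (ENNReal.mul_le_mul_iff_left (measure_ball_pos volume y hδt).ne'
      measure_ball_lt_top.ne).1 h1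
    refine h3.trans ?_
    rw [ENNReal.ofReal_mul (by positivity)]
    gcongr
    rw [ENNReal.ofReal_rpow_of_nonneg (by linarith) hr.le]
    refine ENNReal.ofReal_le_ofReal ?_
    have hq : 1 ≤ 1 + ‖x - y‖ / t := by have : 0 ≤ ‖x - y‖ / t := by positivity
                                        linarith
    calc (1 + ‖x - y‖ / t) ^ n = (1 + ‖x - y‖ / t) ^ (n : ℝ) := (Real.rpow_natCast _ _).symm
      _ ≤ (1 + ‖x - y‖ / t) ^ (N * r) := Real.rpow_le_rpow_of_exponent_le hq hNr
      _ = ((1 + ‖x - y‖ / t) ^ N) ^ r := by rw [Real.rpow_mul (by positivity), Real.rpow_natCast]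
      _ ≤ W ^ r := by
          refine Real.rpow_le_rpow (by positivity) ?_ hr.le
          rw [hW, tangentialWeight]
          refine le_mul_of_one_le_right (by positivity) (one_le_pow₀ ?_)
          have : 0 ≤ ε / t := by positivity
          linarith
  have h3 : a ≤ (ENNReal.ofReal ((δ ^ n)⁻¹) * ENNReal.ofReal W ^ r * M) ^ (1 / r) :=
    by rw [one_div]; exact (ENNReal.le_rpow_inv_iff hr).2 h2
  refine h3.trans_eq ?_
  have hr' : 0 ≤ 1 / r := by positivity
  rw [ENNReal.mul_rpow_of_nonneg _ _ hr', ENNReal.mul_rpow_of_nonneg _ _ hr', ← ENNReal.rpow_mul,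
    mul_one_div_cancel hr.ne', ENNReal.rpow_one]
  ring

theorem exists_rpow_scale_le {C ν : ℝ} (hν : 0 < ν) (B : ℝ≥0∞) (hB : B ≠ ∞) :
    ∃ δ : ℝ, 0 < δ ∧ δ ≤ 1 / 2 ∧ ENNReal.ofReal (C * (2 * δ) ^ ν) * B ≤ 1 / 2 := by
  have h1 : Filter.Tendsto (fun δ : ℝ => ENNReal.ofReal (C * (2 * δ) ^ ν) * B)
      (nhds 0) (nhds 0) := by
    have hc : Continuous fun δ : ℝ => ENNReal.ofReal (C * (2 * δ) ^ ν) := by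
      refine ENNReal.continuous_ofReal.comp (continuous_const.mul ?_)
      exact Continuous.rpow_const (by fun_prop) fun _ => Or.inr hν.le
    simpa [hν.ne'] using ENNReal.Tendsto.mul_const (hc.tendsto 0) (Or.inr hB)
  have h2 : ∀ᶠ δ in nhdsWithin (0 : ℝ) (Ioi 0),
      ENNReal.ofReal (C * (2 * δ) ^ ν) * B ≤ 1 / 2 :=
    (h1.mono_left nhdsWithin_le_nhds).eventually_le_const (by simp)
  have h3 : ∀ᶠ δ in nhdsWithin (0 : ℝ) (Ioi 0), δ ∈ Ioc (0 : ℝ) (1 / 2) :=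
    Ioc_mem_nhdsGT (by norm_num)
  obtain ⟨δ, h4, h5⟩ := (h2.and h3).exists
  exact ⟨δ, h5.1, h5.2, h4⟩

theorem exists_nontangentialMax_le {L : L2Space n →ₗ.[ℂ] L2Space n}
    {K : ℝ → EuclideanSpace ℝ (Fin n) → EuclideanSpace ℝ (Fin n) → ℂ} (hK : IsHeatKernel L K)
    {C b ν : ℝ} (h : HeatKernelEstimates K C b ν) (hC : 0 < C) (hb : 0 < b) (hν : 0 < ν)
    {r : ℝ} (hr : 0 < r) :
    ∃ A : ℝ≥0∞, A ≠ ∞ ∧ ∀ (f : L2Space n) (x : EuclideanSpace ℝ (Fin n)),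
      nontangentialMax K f x ≤ A * ballMax (fun z => radialMax K f z ^ r) x ^ (1 / r) := by
  obtain ⟨N, hN⟩ := exists_nat_ge (max (n : ℝ) (n / r))
  have hNn : n ≤ N := by exact_mod_cast (le_max_left _ _).trans hN
  have hNr : (n : ℝ) ≤ N * r := (div_le_iff₀ hr).1 ((le_max_right _ _).trans hN)
  obtain ⟨G, hG, hGle⟩ := exists_lintegral_gaussWeight_mul_le (n := n) hb N
  obtain ⟨C', hC', hsize⟩ := exists_lintegral_gaussWeight_mul_enorm_le (n := n) hb
  obtain ⟨δ, hδ, hδ2, hδle⟩ := exists_rpow_scale_le (C := C) hν (ENNReal.ofReal (4 ^ N) * G)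
    (by finiteness)
  set A₀ := ENNReal.ofReal ((δ ^ n)⁻¹) ^ (1 / r) with hA₀
  have hA₀t : A₀ ≠ ∞ := ENNReal.rpow_ne_top_of_nonneg (by positivity) ENNReal.ofReal_ne_top
  refine ⟨2 * A₀ * ENNReal.ofReal (4 ^ N), by finiteness, fun f x => ?_⟩
  set X := A₀ * ballMax (fun z => radialMax K f z ^ r) x ^ (1 / r) with hX
  have main : ∀ ε : ℝ, 0 < ε → ∀ t : ℝ, 0 < t → ∀ y,
      ‖heatValue K f (t ^ 2) y‖ₑ ≤ 2 * X * ENNReal.ofReal (tangentialWeight N ε x t y) := by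
    intro ε hε
    set F := ⨆ (t : ℝ) (_ : 0 < t) (y : EuclideanSpace ℝ (Fin n)),
      ‖heatValue K f (t ^ 2) y‖ₑ / ENNReal.ofReal (tangentialWeight N ε x t y) with hF
    have hW1 : ∀ t : ℝ, 0 < t → ∀ y, 1 ≤ tangentialWeight N ε x t y :=
      fun t ht y => one_le_tangentialWeight hε ht x y
    have hW0 : ∀ t : ℝ, 0 < t → ∀ y, ENNReal.ofReal (tangentialWeight N ε x t y) ≠ 0 :=
      fun t ht y => (ENNReal.ofReal_pos.2 (by linarith [hW1 t ht y])).ne'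
    have hF_le : ∀ {B : ℝ≥0∞}, (∀ t : ℝ, 0 < t → ∀ y, ‖heatValue K f (t ^ 2) y‖ₑ ≤
        B * ENNReal.ofReal (tangentialWeight N ε x t y)) → F ≤ B := by
      intro B hB
      refine iSup_le fun t => iSup_le fun ht => iSup_le fun y => ?_
      exact ENNReal.div_le_of_le_mul (hB t ht y)
    have hle_F : ∀ t : ℝ, 0 < t → ∀ y, ‖heatValue K f (t ^ 2) y‖ₑ ≤
        F * ENNReal.ofReal (tangentialWeight N ε x t y) := by
      intro t ht y
      rw [← ENNReal.div_le_iff (hW0 t ht y) ENNReal.ofReal_ne_top]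
      exact le_iSup_of_le t (le_iSup_of_le ht (le_iSup_of_le y le_rfl))
    -- As `t → 0` the crude bound grows like `t⁻ⁿ`. This is absorbed by `(1 + ε / t) ^ N`, since
    -- `t⁻ⁿ = ε⁻ⁿ (ε / t)ⁿ` and `n ≤ N`.
    have hFt : F ≠ ∞ := by
      have hI := lintegral_enorm_sq_ne_top f
      refine ne_top_of_le_ne_top (b := ENNReal.ofReal C *
        (C' + ENNReal.ofReal ((ε ^ n)⁻¹) * ∫⁻ z, ‖f z‖ₑ ^ 2)) (by finiteness)
        (hF_le fun t ht y => ?_)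
      refine (h.enorm_heatValue_le hC ht f y).trans ?_
      rw [mul_assoc]
      gcongr
      refine (hsize t ht f y).trans ?_
      rw [add_mul]
      refine add_le_add ?_ ?_
      · exact le_mul_of_one_le_right zero_le (ENNReal.one_le_ofReal.2 (hW1 t ht y))
      · rw [mul_right_comm, ← ENNReal.ofReal_mul (by positivity)]
        gcongr
        have h1 : (ε / t) ^ n ≤ tangentialWeight N ε x t y := by
          have h2 : 0 ≤ ε / t := by positivity
          have h3 : 0 ≤ ‖x - y‖ / t := by positivity
          calc (ε / t) ^ n ≤ (1 + ε / t) ^ n := by gcongr; linarith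
            _ ≤ (1 + ε / t) ^ N := pow_le_pow_right₀ (by linarith) hNn
            _ ≤ _ := le_mul_of_one_le_left (by positivity) (one_le_pow₀ (by linarith))
        calc (t ^ n)⁻¹ = (ε ^ n)⁻¹ * (ε / t) ^ n := by rw [div_pow]; field_simp
          _ ≤ _ := by gcongr
    have habs : F ≤ X + F / 2 := by
      refine hF_le fun t ht y => ?_
      set W := tangentialWeight N ε x t y with hWdef
      -- Half of the heat time `t ^ 2`, so that `e^{-t²L}` is the square of `e^{-τ²L}`.
      set τ := t / √2 with hτdef
      have hτ : 0 < τ := by positivity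
      have hs2 : √2 ^ 2 = 2 := Real.sq_sqrt (by norm_num)
      have hs2' : √2 ≤ 2 := by nlinarith [Real.sqrt_nonneg 2]
      have htτ : t ^ 2 = τ ^ 2 + τ ^ 2 := by rw [hτdef, div_pow, hs2]; ring
      have htτ' : t ≤ 2 * τ := by
        have : t = √2 * τ := by rw [hτdef]; field_simp
        nlinarith
      have hosc : ∀ z ∈ ball y (δ * t),
          ‖heatValue K f (t ^ 2) y - heatValue K f (t ^ 2) z‖ₑ ≤ F / 2 * ENNReal.ofReal W := by
        intro z hz
        have hz' : ‖y - z‖ ≤ δ * t := by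
          rw [mem_ball, dist_comm, dist_eq_norm] at hz; exact hz.le
        have hzτ : ‖y - z‖ / τ ≤ 2 * δ := by
          rw [div_le_iff₀ hτ]; nlinarith
        have hzτ' : ‖y - z‖ ≤ τ := by nlinarith
        refine (enorm_heatValue_sub_le_lintegral hK h hC hb hν hτ ht htτ f hzτ').trans ?_
        have hint := lintegral_gaussWeight_mul_le_of_le hε ht hτ htτ' (x := x) (hGle τ hτ)
          (hle_F τ hτ) y
        calc _ ≤ ENNReal.ofReal (C * (2 * δ) ^ ν) *
              (F * ENNReal.ofReal (4 ^ N * W) * G) := by gcongr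
          _ = (ENNReal.ofReal (C * (2 * δ) ^ ν) * (ENNReal.ofReal (4 ^ N) * G)) *
              (F * ENNReal.ofReal W) := by
            rw [ENNReal.ofReal_mul (p := 4 ^ N) (by positivity)]; ring
          _ ≤ 1 / 2 * (F * ENNReal.ofReal W) := by gcongr
          _ = _ := by rw [← mul_assoc, one_div, ENNReal.div_eq_inv_mul]
      have hball : ∀ z ∈ ball y (δ * t),
          ‖heatValue K f (t ^ 2) y‖ₑ - F / 2 * ENNReal.ofReal W ≤ radialMax K f z := by
        intro z hz
        rw [tsub_le_iff_right]
        calc ‖heatValue K f (t ^ 2) y‖ₑ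
            = ‖heatValue K f (t ^ 2) z +
                (heatValue K f (t ^ 2) y - heatValue K f (t ^ 2) z)‖ₑ := by
              rw [add_sub_cancel]
          _ ≤ ‖heatValue K f (t ^ 2) z‖ₑ +
                ‖heatValue K f (t ^ 2) y - heatValue K f (t ^ 2) z‖ₑ := enorm_add_le _ _
          _ ≤ _ := add_le_add (le_iSup₂
              (f := fun (t : ℝ) (_ : 0 < t) => ‖heatValue K f (t ^ 2) z‖ₑ) t ht) (hosc z hz)
      have hfin := le_mul_ballMax_of_le_on_ball hr hNr hδ (by linarith) ht hε (x := x) hball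
      rw [tsub_le_iff_right] at hfin
      refine hfin.trans_eq ?_
      rw [← hWdef, ← hA₀, ← hX]
      ring
    have hF2 : F ≤ 2 * X := by
      -- Cancelling `F / 2` is where the finiteness of `F` is needed.
      have h1 : F / 2 + F / 2 ≤ X + F / 2 := by rwa [ENNReal.add_halves]
      have h2 : F / 2 ≤ X :=
        (ENNReal.add_le_add_iff_right (ENNReal.div_ne_top hFt two_ne_zero)).1 h1
      rw [ENNReal.div_le_iff two_ne_zero ENNReal.ofNat_ne_top] at h2
      rwa [mul_comm]
    intro t ht y
    refine (hle_F t ht y).trans ?_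
    gcongr
  refine iSup_le fun t => iSup_le fun ht => iSup_le fun y => iSup_le fun hy => ?_
  -- Choosing `ε = t` is allowed because `X` does not involve `ε`; on the cone `|y - x| < t` both
  -- factors of the weight are then at most `2 ^ N`.
  refine (main t ht t ht y).trans ?_
  rw [hX]
  have hW : tangentialWeight N t x t y ≤ 4 ^ N := by
    have h1 : ‖x - y‖ / t ≤ 1 := by
      rw [div_le_one ht, norm_sub_rev]; exact hy.le
    calc tangentialWeight N t x t y ≤ (1 + 1) ^ N * (1 + 1) ^ N := by
          unfold tangentialWeight
          rw [div_self ht.ne']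
          gcongr
      _ = 4 ^ N := by rw [← mul_pow]; norm_num
  calc _ ≤ 2 * (A₀ * ballMax (fun z => radialMax K f z ^ r) x ^ (1 / r)) *
        ENNReal.ofReal (4 ^ N) := by gcongr
    _ = _ := by ring

end Pointwise

/-! ### Comparison of the maximal functions in `L^{p(·)}` -/

section Comparison

open Metric Filter Topology

variable {n : ℕ} {p : EuclideanSpace ℝ (Fin n) → ℝ}

theorem IsGloballyLogHolder.continuous (hlog : IsGloballyLogHolder p) : Continuous p := by
  obtain ⟨C, -, h⟩ := hlog.locally_log
  rw [continuous_iff_continuousAt]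
  intro x
  rw [continuousAt_iff_punctured_nhds, tendsto_iff_norm_sub_tendsto_zero]
  have h1 : Tendsto (fun y => ‖y - x‖) (𝓝[≠] x) (𝓝[>] 0) := tendsto_norm_sub_self_nhdsNE x
  have h2 : Tendsto (fun y => Real.exp 1 + ‖y - x‖⁻¹) (𝓝[≠] x) atTop :=
    tendsto_atTop_add_const_left _ _ (tendsto_inv_nhdsGT_zero.comp h1)
  have h3 : Tendsto (fun y => C / Real.log (Real.exp 1 + ‖y - x‖⁻¹)) (𝓝[≠] x) (𝓝 0) :=
    (Real.tendsto_log_atTop.comp h2).const_div_atTop C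
  refine squeeze_zero (fun _ => norm_nonneg _) (fun y => ?_) h3
  rw [Real.norm_eq_abs]
  simpa using h y x

/-- Log-Hölder continuity makes `p` continuous, so `{p < m}` is open; being null, it is empty. -/
theorem IsVariableExponent.exists_forall_le (hp : IsVariableExponent p)
    (hlog : IsGloballyLogHolder p) : ∃ m : ℝ, 0 < m ∧ ∀ x, m ≤ p x := by
  obtain ⟨m, hm0, hm⟩ := EReal.lt_iff_exists_real_btwn.1 hp.essInf_pos
  refine ⟨m, by exact_mod_cast hm0, ?_⟩
  have hae : ∀ᵐ x, m ≤ p x := by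
    filter_upwards [ae_lt_of_lt_essInf hm] with x hx
    exact_mod_cast hx.le
  by_contra! hc
  obtain ⟨x, hx⟩ := hc
  have hopen : IsOpen {x | p x < m} := isOpen_lt hlog.continuous continuous_const
  have h0 : volume {x | p x < m} = 0 := by
    rw [ae_iff] at hae
    simpa using hae
  exact (hopen.measure_pos volume ⟨x, hx⟩).ne' h0

/-- `pinf` is the limit of `p` at infinity; `n > 0` supplies points of arbitrarily large norm. -/
theorem le_of_forall_abs_sub_le_div_log (hn : 0 < n) {m C pinf : ℝ} (hC : 0 < C)
    (hm : ∀ x, m ≤ p x) (h : ∀ x, |p x - pinf| ≤ C / Real.log (Real.exp 1 + ‖x‖)) :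
    m ≤ pinf := by
  have : Nonempty (Fin n) := ⟨⟨0, hn⟩⟩
  by_contra! hlt
  have hd : 0 < m - pinf := by linarith
  obtain ⟨x, hx⟩ := exists_norm_eq (EuclideanSpace ℝ (Fin n))
    (Real.exp_pos (C / (m - pinf) + 1)).le
  have h1 := (abs_le.1 (h x)).2
  have h2 : C / (m - pinf) + 1 ≤ Real.log (Real.exp 1 + ‖x‖) := by
    rw [hx]
    conv_lhs => rw [← Real.log_exp (C / (m - pinf) + 1)]
    exact Real.log_le_log (Real.exp_pos _) (by linarith [Real.exp_pos 1])
  have h3 : 0 < C / (m - pinf) := by positivity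
  have h4 : m - pinf ≤ C / Real.log (Real.exp 1 + ‖x‖) := by linarith [hm x]
  rw [le_div_iff₀ (by linarith)] at h4
  have h5 : (m - pinf) * (C / (m - pinf) + 1) = C + (m - pinf) := by field_simp
  nlinarith

theorem ballMax_const_mul_le {c : ℝ≥0∞} (hc : c ≠ ∞) (g : EuclideanSpace ℝ (Fin n) → ℝ≥0∞)
    (x : EuclideanSpace ℝ (Fin n)) : ballMax (fun z => c * g z) x ≤ c * ballMax g x := by
  refine ballMax_le_iff.2 fun a ρ hx => ?_
  rw [setLAverage_eq, lintegral_const_mul' _ _ hc, mul_div_assoc, ← setLAverage_eq]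
  gcongr
  exact laverage_le_ballMax g hx

/-- The maximal operator `g ↦ M(gʳ)^{1/r}` is bounded on `L^{p(·)}` for small `r`, in modular
form. -/
theorem exists_modular_ballMax_le (hn : 0 < n) (hp : IsVariableExponent p)
    (hlog : IsGloballyLogHolder p) {m : ℝ} (hm : 0 < m) (hmp : ∀ x, m ≤ p x) :
    ∃ C : ℝ≥0∞, C ≠ ∞ ∧ ∀ g : EuclideanSpace ℝ (Fin n) → ℝ≥0∞, Measurable g →
      modular p g ≤ 1 →
      modular p (fun x => ballMax (fun z => g z ^ (m / 2)) x ^ (1 / (m / 2))) ≤ C := by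
  obtain ⟨C₁, hC₁, hloc⟩ := hlog.locally_log
  obtain ⟨C₂, pinf, hC₂, hinf⟩ := hlog.at_infinity
  have hmpinf := le_of_forall_abs_sub_le_div_log hn hC₂ hmp hinf
  have hpos : ∀ a : ℝ, 0 ≤ a → 0 < Real.log (Real.exp 1 + a) := fun a ha =>
    Real.log_pos (by linarith [Real.add_one_le_exp (1 : ℝ)])
  -- The exponent `p / m` is at least `1`, and one constant `(C₁ + C₂) / m` serves both log-Hölder
  -- conditions.
  obtain ⟨C, hC, hmain⟩ := exists_lintegral_ballMax_rpow_le hn (s := fun x => p x / m)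
    (sinf := pinf / m) (A := (C₁ + C₂) / m) (hp.measurable.div_const m)
    (fun x => (one_le_div hm).2 (hmp x)) ((one_le_div hm).2 hmpinf) (by positivity)
    (fun x y => by
      have := hpos (1 / ‖x - y‖) (by positivity)
      rw [← sub_div, abs_div, abs_of_pos hm, div_right_comm]
      gcongr
      refine (hloc x y).trans ?_
      gcongr
      linarith)
    (fun x => by
      have := hpos ‖x‖ (by positivity)
      rw [← sub_div, abs_div, abs_of_pos hm, div_right_comm]
      gcongr
      refine (hinf x).trans ?_
      gcongr
      linarith)
  refine ⟨C, hC, fun g hg hmod => ?_⟩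
  have h := hmain (fun z => g z ^ (m / 2)) (hg.pow_const _) (by
    refine le_of_eq_of_le (lintegral_congr fun x => ?_) hmod
    rw [← ENNReal.rpow_two, ← ENNReal.rpow_mul, ← ENNReal.rpow_mul]
    congr 1
    field_simp)
  refine le_of_eq_of_le (lintegral_congr fun x => ?_) h
  rw [← ENNReal.rpow_two, ← ENNReal.rpow_mul, ← ENNReal.rpow_mul]
  congr 1
  field_simp

/-- Since `D ≥ 1` and `p ≥ m`, each `D ^ p x` is at least `D ^ m`. A modular bound thus becomes a
norm bound after rescaling. -/
theorem modular_div_le {m : ℝ} (hm : 0 < m) (hmp : ∀ x, m ≤ p x) {D : ℝ≥0∞} (hD : 1 ≤ D)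
    (hDt : D ≠ ∞) (g : EuclideanSpace ℝ (Fin n) → ℝ≥0∞) :
    modular p (fun x => g x / D) ≤ modular p g / D ^ m := by
  have hDm : (D ^ m)⁻¹ ≠ ∞ :=
    ENNReal.inv_ne_top.2 (ENNReal.rpow_pos (one_pos.trans_le hD) hDt).ne'
  unfold modular
  rw [ENNReal.div_eq_inv_mul, ← lintegral_const_mul' _ _ hDm]
  refine lintegral_mono fun x => ?_
  have hpx : 0 ≤ p x := hm.le.trans (hmp x)
  rw [ENNReal.div_rpow_of_nonneg _ _ hpx, ENNReal.div_eq_inv_mul]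
  gcongr ?_⁻¹ * _
  exact ENNReal.rpow_le_rpow_of_exponent_le hD (hmp x)

end Comparison

theorem mainTheorem6 {n : ℕ} (hn : 0 < n)
    (p : EuclideanSpace ℝ (Fin n) → ℝ)
    (hp : IsVariableExponent p) (hlog : IsGloballyLogHolder p)
    (L : L2Space n →ₗ.[ℂ] L2Space n) (hL : IsNonnegSelfAdjoint L)
    (K : ℝ → EuclideanSpace ℝ (Fin n) → EuclideanSpace ℝ (Fin n) → ℂ)
    (hK : IsHeatKernel L K) (hGauss : HasGaussianBound K) (hHolder : HasHolderBound K) :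
    ∃ C : ℝ≥0, 0 < C ∧ ∀ f : L2Space n,
      luxemburgNorm p (nontangentialMax K f) ≤ C * luxemburgNorm p (radialMax K f) := by
  obtain ⟨C, b, ν, hC, hb, hν, hest⟩ := exists_heatKernelEstimates hK hGauss hHolder
  obtain ⟨m, hm, hmp⟩ := hp.exists_forall_le hlog
  have hr : 0 < m / 2 := half_pos hm
  obtain ⟨A, hA, hpt⟩ := exists_nontangentialMax_le hK hest hC hb hν hr
  obtain ⟨B, hB, hmod⟩ := exists_modular_ballMax_le hn hp hlog hm hmp
  -- Chosen so that `D ≥ 1` and `D ^ m ≥ B`: dividing by `D` brings a modular of size `B` down to at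
  -- most `1`.
  set D : ℝ≥0∞ := 1 + B ^ m⁻¹ with hD
  have hD1 : 1 ≤ D := le_self_add
  have hBm : B ^ m⁻¹ ≠ ∞ := ENNReal.rpow_ne_top_of_nonneg (by positivity) hB
  have hDt : D ≠ ∞ := by finiteness
  have hDm : B ≤ D ^ m := (ENNReal.rpow_inv_le_iff hm).1 le_add_self
  have hEt : (A + 1) * D ≠ ∞ := by finiteness
  have hE0 : (A + 1) * D ≠ 0 := mul_ne_zero (by simp) (one_pos.trans_le hD1).ne'
  refine ⟨((A + 1) * D).toNNReal, ENNReal.toNNReal_pos hE0 hEt, fun f => ?_⟩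
  rw [ENNReal.coe_toNNReal hEt, mul_comm, ← ENNReal.div_le_iff hE0 hEt]
  -- Each `l` admissible for the radial function makes `l * ((A + 1) * D)` admissible for the
  -- non-tangential one.
  refine le_sInf fun l hl => ?_
  obtain ⟨hl0, hlt, hlmod⟩ := hl
  rw [ENNReal.div_le_iff hE0 hEt]
  refine sInf_le ⟨ENNReal.mul_pos hl0.ne' hE0, ENNReal.mul_lt_top hlt hEt.lt_top, ?_⟩
  set g := fun x => radialMax K f x / l with hg
  have hgm : Measurable g := (measurable_radialMax hest hC hb hν f).div_const l
  set G := fun x => ballMax (fun z => g z ^ (m / 2)) x ^ (1 / (m / 2)) with hG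
  have hscale : ∀ x, ballMax (fun z => radialMax K f z ^ (m / 2)) x ^ (1 / (m / 2)) ≤ l * G x := by
    intro x
    have hlr : l ^ (m / 2) ≠ ∞ := ENNReal.rpow_ne_top_of_nonneg hr.le hlt.ne
    have h1 := ballMax_const_mul_le hlr (fun z => g z ^ (m / 2)) x
    have h2 : (fun z => l ^ (m / 2) * g z ^ (m / 2)) = fun z => radialMax K f z ^ (m / 2) := by
      funext z
      rw [← ENNReal.mul_rpow_of_nonneg _ _ hr.le, hg, ENNReal.mul_div_cancel hl0.ne' hlt.ne]
    rw [h2] at h1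
    refine (ENNReal.rpow_le_rpow h1 (by positivity)).trans_eq ?_
    rw [ENNReal.mul_rpow_of_nonneg _ _ (by positivity), ← ENNReal.rpow_mul,
      mul_one_div_cancel hr.ne', ENNReal.rpow_one]
  have hle : ∀ x, nontangentialMax K f x / (l * ((A + 1) * D)) ≤ G x / D := by
    intro x
    refine ENNReal.div_le_of_le_mul ?_
    have hDD : G x / D * (l * ((A + 1) * D)) = (A + 1) * (l * G x) := by
      calc _ = (A + 1) * l * (G x / D * D) := by ring
        _ = (A + 1) * l * G x := by
          rw [ENNReal.div_mul_cancel (one_pos.trans_le hD1).ne' hDt]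
        _ = _ := by ring
    rw [hDD]
    refine (hpt f x).trans ?_
    gcongr
    · exact le_self_add
    · exact hscale x
  calc modular p (fun x => nontangentialMax K f x / (l * ((A + 1) * D)))
      ≤ modular p (fun x => G x / D) :=
        lintegral_mono fun x => ENNReal.rpow_le_rpow (hle x) (hp.pos x).le
    _ ≤ modular p G / D ^ m := modular_div_le hm hmp hD1 hDt G
    _ ≤ D ^ m / D ^ m := by
        gcongr
        exact (hmod g hgm hlmod).trans hDm
    _ ≤ 1 := ENNReal.div_self_le_one
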